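/- **Setting.** Let $\hat\Sigma$ be a simplicial complex on a set $X$: a family of finite subsets of $X$ (simplices), closed under taking subsets and containing $\varnothing$, and let $m:\hat\Sigma\to(0,\infty)$. Write $\tau\prec\sigma$ (or $\sigma\succ\tau$) if $\tau\subseteq\sigma$ and $|\sigma\setminus\tau|=1$. Put $\Sigma=\hat\Sigma$ if the sum of $m$ over all vertices is finite and $\Sigma=\hat\Sigma\setminus\{\varnothing\}$ otherwise, and assume that $(\Sigma,m)$ is a weighted simplicial complex, i.e. $\sum_{\sigma\succ\tau}m(\sigma)<\infty$ for all $\tau\in\Sigma$. Let $C(\Sigma)$ be the space of complex functions on $\Sigma$, $\ell^2=\{\omega\in C(\Sigma):\sum_{\Sigma}m|\omega|^2<\infty\}$, and let $\delta:C(\Sigma)\to C(\Sigma)$, $\delta\omega(\sigma)=\sum_{\tau\prec\sigma}\theta(\tau,\sigma)\omega(\tau)$, be a coboundary operator, where $\theta(\tau,\sigma)\in\{\pm1\}$ for $\tau\prec\sigma$ and $\delta\delta=0$. The boundary operator is $$\partial\omega(\rho)=\frac1{m(\rho)}\sum_{\tau\succ\rho}m(\tau)\theta(\rho,\tau)\omega(\tau),\qquad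 D(\partial)=\Big\{\omega\in C(\Sigma):\sum_{\tau\succ\rho}m(\tau)|\omega(\tau)|<\infty\text{ for all }\rho\in\Sigma\Big\},$$ and $\partial_N$ is the restriction of $\partial$ to $\{\omega\in\ell^2:\partial\omega\in\ell^2\}$ (note $\ell^2\subseteq D(\partial)$). For $\rho\in\Sigma$ the link is $\mathrm{lk}(\rho)=\{v:\{v\}\in\Sigma,\ v\rho:=\{v\}\cup\rho\in\Sigma,\ v\rho\succ\rho\}$, with weights $m_\rho(v)=m(v\rho)$ and graph $b_\rho(v,v')=m(vv'\rho)$ for $v\ne v'$ with $vv'\rho:=\{v,v'\}\cup\rho\in\Sigma$, and $b_\rho(v,v')=0$ otherwise. Two vertices are adjacent if $b_\rho(v,v')>0$. A connected component of $b_\rho$ is recurrent if the random walk $(Y_n)$ on it with transition probabilities $b_\rho(x,y)/\sum_z b_\rho(x,z)$ (staying put at a vertex without neighbours) satisfies $\mathbb P(Y_k=y\text{ for some }k>0\mid Y_0=x)=1$ for all its vertices $x,y$; otherwise it is transient. A monopole at $v_0\in\mathrm{lk}(\rho)$ is a function $u:\mathrm{lk}(\rho)\to\mathbb C$ with $\sum_{v,v'}b_\rho(v,v')|u(v)-u(v')|^2<\infty$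 and $\mathcal L_\rho u=1_{v_0}$, where $\mathcal L_\rho u(v)=\frac1{m_\rho(v)}\sum_{v'}b_\rho(v,v')(u(v)-u(v'))$. Let $\pi^\rho u(v\rho)=\theta(\rho,v\rho)u(v)$ for $v\in\mathrm{lk}(\rho)$ and $\pi^\rho u(\tau)=0$ for $\tau\not\succ\rho$. The pair $(\Sigma,m)$ is locally balanced if for every $\rho\in\Sigma$ the quotients $m(vv'\rho)/m(vv'\rho\setminus\{w\})$, over all $v\neq v'$ in $\mathrm{lk}(\rho)$ with $vv'\rho\in\Sigma$ and all $w\in\rho$, are bounded. **Theorem.** Assume that $(\Sigma,m)$ is locally balanced. Then: 1. $\partial\partial_N=0$ if and only if for every $\rho\in\Sigma$ all connected components of $b_\rho$ are recurrent. 2. If $\rho\in\Sigma$ and some connected component of $b_\rho$ is transient, then there are a vertex $v_0$ in this component and a monopole $u$ at $v_0$ on $\mathrm{lk}(\rho)$. 3. For every $\rho\in\Sigma$, every $v_0\in\mathrm{lk}(\rho)$ and every monopole $u$ at $v_0$, the function $\omega=\delta\pi^\rho u$ satisfies $\omega\in\ell^2$, $\partial\omega\in\ell^2$ and $\partial\partial\omega(\rho)\neq0$.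 -/

import Mathlib

open MeasureTheory ProbabilityTheory

noncomputable section

/-! ### Weighted graphs, random walks and recurrence -/

/-- A graph over `V`: a symmetric, locally summable edge weight `b : V × V → [0, ∞)` with vanishing
diagonal. -/
structure WGraph (V : Type*) where
  b : V → V → ℝ
  nonneg : ∀ x y, 0 ≤ b x y
  symm : ∀ x y, b x y = b y x
  diag : ∀ x, b x x = 0
  summable : ∀ x, Summable (b x)

namespace WGraph

variable {V : Type*} (G : WGraph V)

/-- The combinatorial graph: `x` and `y` are neighbours iff `b x y > 0`. -/
def toSimpleGraph : SimpleGraph V where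
  Adj x y := 0 < G.b x y
  symm := ⟨fun x y h => by rwa [G.symm y x]⟩
  loopless := ⟨fun x h => by simp [G.diag x] at h⟩

/-- The restriction of the graph to a set of vertices. -/
def restrict (S : Set V) : WGraph S where
  b x y := G.b x y
  nonneg x y := G.nonneg x y
  symm x y := G.symm x y
  diag x := G.diag x
  summable x := (G.summable x).subtype S

/-- One step of the random walk: from `x` to `y` with probability `b x y / ∑ z, b x z`. At a vertex
without neighbours the walk stays where it is. -/
def step (x : V) : PMF V :=
  open Classical in
  if h : ∑' y, ENNReal.ofReal (G.b x y) = 0 then PMF.pure x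
  else PMF.normalize (fun y => ENNReal.ofReal (G.b x y)) h (G.summable x).tsum_ofReal_ne_top

/-- The transition kernel of the random walk. -/
def stepKernel [MeasurableSpace V] [DiscreteMeasurableSpace V] : Kernel V V where
  toFun x := (G.step x).toMeasure
  measurable' := Measurable.of_discrete

instance [MeasurableSpace V] [DiscreteMeasurableSpace V] : IsMarkovKernel G.stepKernel :=
  ⟨fun x => inferInstanceAs (IsProbabilityMeasure (G.step x).toMeasure)⟩

/-- The law on `ℕ → V` of the random walk `Y 0, Y 1, …` started at `Y 0 = x`. -/
def walkLaw [MeasurableSpace V] [DiscreteMeasurableSpace V] (x : V) : Measure (ℕ → V) :=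
  Kernel.traj (X := fun _ => V)
    (fun n => G.stepKernel.comap (fun h : Finset.Iic n → V => h ⟨n, Finset.mem_Iic.2 le_rfl⟩)
      (measurable_pi_apply _))
    0 (fun _ => x)

/-- The random walk started anywhere almost surely visits (at a positive time) every vertex. To be
used for connected graphs. -/
def Recurrent : Prop :=
  letI : MeasurableSpace V := ⊤
  ∀ x y : V, G.walkLaw x {Y | ∃ k : ℕ, 0 < k ∧ Y k = y} = 1

/-- The connected component `c`, as a graph of its own. -/
def component (c : G.toSimpleGraph.ConnectedComponent) : WGraph c.supp := G.restrict c.supp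

/-- Functions of finite energy. -/
def finiteEnergy : Set (V → ℂ) :=
  {u | Summable fun p : V × V => G.b p.1 p.2 * ‖u p.1 - u p.2‖ ^ 2}

/-- The formal Laplacian of the graph with respect to the vertex weight `μ`. -/
def laplacian (μ : V → ℝ) (u : V → ℂ) (x : V) : ℂ :=
  (1 / (μ x : ℂ)) * ∑' y, (G.b x y : ℂ) * (u x - u y)

/-- `u` is a monopole at `v₀`: it has finite energy and its Laplacian is `1_{v₀}`. -/
def IsMonopole [DecidableEq V] (μ : V → ℝ) (v₀ : V) (u : V → ℂ) : Prop :=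
  u ∈ G.finiteEnergy ∧ G.laplacian μ u = Pi.single v₀ 1

end WGraph

/-! ### Weighted simplicial complexes -/

/-- `τ ≺ σ`: `τ` is a face of `σ`, i.e. `τ ⊆ σ` and `σ` has exactly one element more. -/
def IsFace {X : Type*} (τ σ : Finset X) : Prop := τ ⊆ σ ∧ σ.card = τ.card + 1

/-- A simplicial complex on a set `X`, together with a weight `m` which is positive on all its
simplices (the values of `m` elsewhere are never used). The empty simplex belongs to every
complex. -/
structure PreWeightedComplex (X : Type*) where
  allSimplices : Set (Finset X)
  empty_mem : ∅ ∈ allSimplices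
  down_closed : ∀ σ ∈ allSimplices, ∀ τ ⊆ σ, τ ∈ allSimplices
  m : Finset X → ℝ
  m_pos : ∀ σ ∈ allSimplices, 0 < m σ

namespace PreWeightedComplex

variable {X : Type*} (K : PreWeightedComplex X)

/-- The set `Σ`: all simplices if the total vertex weight is finite, and all nonempty simplices
otherwise. -/
def simplices : Set (Finset X) :=
  {σ | σ ∈ K.allSimplices ∧
    (σ = ∅ → Summable fun x : {x : X // {x} ∈ K.allSimplices} => K.m {x.1})}

/-- The elements of `Σ` as a type; `C(Σ)` is `K.Simplex → ℂ`. -/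
abbrev Simplex : Type _ := {σ : Finset X // σ ∈ K.simplices}

end PreWeightedComplex

/-- A weighted simplicial complex `(Σ, m)`: the weight is locally summable. -/
structure WeightedComplex (X : Type*) extends PreWeightedComplex X where
  locallySummable : ∀ τ : toPreWeightedComplex.Simplex,
    Summable fun σ : {σ : toPreWeightedComplex.Simplex // IsFace τ.1 σ.1} => m σ.1.1

namespace WeightedComplex

variable {X : Type*} (K : WeightedComplex X)

/-- `ω ∈ ℓ²(Σ, m)`. -/
def IsL2 (ω : K.Simplex → ℂ) : Prop := Summable fun σ : K.Simplex => K.m σ.1 * ‖ω σ‖ ^ 2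

/-- The domain `D(∂)` of the boundary operator. -/
def boundaryDomain : Set (K.Simplex → ℂ) :=
  {ω | ∀ ρ : K.Simplex,
    Summable fun τ : {τ : K.Simplex // IsFace ρ.1 τ.1} => K.m τ.1.1 * ‖ω τ.1‖}

/-- A coboundary operator on `Σ`: a linear operator on `C(Σ)` whose matrix entries
`θ τ σ = δ 1_τ (σ)` are `±1` if `τ ≺ σ` and `0` otherwise, which acts through its matrix, and which
satisfies `δ δ = 0`. -/
structure Coboundary [DecidableEq X] where
  δ : (K.Simplex → ℂ) →ₗ[ℂ] (K.Simplex → ℂ)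
  entry : ∀ τ σ : K.Simplex, δ (Pi.single τ 1) σ ∈ ({1, -1, 0} : Set ℂ)
  entry_ne_zero_iff : ∀ τ σ : K.Simplex, δ (Pi.single τ 1) σ ≠ 0 ↔ IsFace τ.1 σ.1
  apply_eq : ∀ (ω : K.Simplex → ℂ) (σ : K.Simplex),
    δ ω σ = ∑ᶠ τ : {τ : K.Simplex // IsFace τ.1 σ.1}, δ (Pi.single τ.1 1) σ * ω τ.1
  comp_self : ∀ ω, δ (δ ω) = 0

namespace Coboundary

variable [DecidableEq X] {K} (d : K.Coboundary)

/-- The incidence numbers `θ(τ, σ)`. -/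
def θ (τ σ : K.Simplex) : ℂ := d.δ (Pi.single τ 1) σ

/-- The action of the boundary operator `∂` (meaningful on `K.boundaryDomain`). -/
def boundary (ω : K.Simplex → ℂ) (ρ : K.Simplex) : ℂ :=
  (1 / (K.m ρ.1 : ℂ)) *
    ∑' τ : {τ : K.Simplex // IsFace ρ.1 τ.1}, (K.m τ.1.1 : ℂ) * d.θ ρ τ.1 * ω τ.1

/-- The domain of the Neumann boundary operator `∂_N`: all `ω ∈ ℓ²` with `∂ω ∈ ℓ²`. -/
def neumannDomain : Set (K.Simplex → ℂ) :=
  {ω | K.IsL2 ω ∧ ω ∈ K.boundaryDomain ∧ K.IsL2 (d.boundary ω)}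

/-- `∂ ∂_N = 0`, on the natural domain of the composition. -/
def NeumannComplexProperty : Prop :=
  ∀ ω ∈ d.neumannDomain, d.boundary ω ∈ K.boundaryDomain → d.boundary (d.boundary ω) = 0

end Coboundary

/-! ### Links -/

section Link

variable [DecidableEq X]

/-- The vertex set of the link of `ρ`. -/
def link (ρ : K.Simplex) : Set X :=
  {v | {v} ∈ K.simplices ∧ insert v ρ.1 ∈ K.simplices ∧ IsFace ρ.1 (insert v ρ.1)}

/-- The vertex weight `m_ρ(v) = m(vρ)` on the link. -/
def linkWeight (ρ : K.Simplex) (v : K.link ρ) : ℝ := K.m (insert v.1 ρ.1)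

open Classical in
/-- The edge weight `b_ρ(v, v') = m(vv'ρ)` on the link, where `m` counts as `0` on sets which are
not simplices. -/
def linkEdge (ρ : K.Simplex) (v v' : K.link ρ) : ℝ :=
  if v ≠ v' ∧ insert v.1 (insert v'.1 ρ.1) ∈ K.simplices then
    K.m (insert v.1 (insert v'.1 ρ.1)) else 0

theorem notMem_of_link {ρ : K.Simplex} (w : K.link ρ) : w.1 ∉ ρ.1 := by
  intro hw
  have h := w.2.2.2.2
  rw [Finset.insert_eq_of_mem hw] at h
  omega

theorem linkEdge_symm (ρ : K.Simplex) (v v' : K.link ρ) :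
    K.linkEdge ρ v v' = K.linkEdge ρ v' v := by
  unfold linkEdge
  have h : insert v.1 (insert v'.1 ρ.1) = insert v'.1 (insert v.1 ρ.1) := Finset.insert_comm _ _ _
  by_cases hv : v ≠ v' ∧ insert v.1 (insert v'.1 ρ.1) ∈ K.simplices
  · rw [if_pos hv, if_pos ⟨hv.1.symm, h ▸ hv.2⟩, h]
  · rw [if_neg hv, if_neg fun hv' => hv ⟨hv'.1.symm, h ▸ hv'.2⟩]

/-- The edges at `v` in the link correspond to cofaces of `vρ`. -/
def linkCoface (ρ : K.Simplex) (v : K.link ρ)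
    (x : {v' : K.link ρ // v ≠ v' ∧ insert v.1 (insert v'.1 ρ.1) ∈ K.simplices}) :
    {σ : K.Simplex // IsFace (insert v.1 ρ.1) σ.1} :=
  ⟨⟨insert v.1 (insert x.1.1 ρ.1), x.2.2⟩, by
    have h : insert v.1 (insert x.1.1 ρ.1) = insert x.1.1 (insert v.1 ρ.1) :=
      Finset.insert_comm _ _ _
    have hn : x.1.1 ∉ insert v.1 ρ.1 := by
      simp only [Finset.mem_insert, not_or]
      exact ⟨fun h => x.2.1 (Subtype.ext h.symm), K.notMem_of_link _⟩
    change IsFace (insert v.1 ρ.1) (insert v.1 (insert x.1.1 ρ.1))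
    rw [h]
    exact ⟨Finset.subset_insert _ _, Finset.card_insert_of_notMem hn⟩⟩

theorem linkCoface_injective (ρ : K.Simplex) (v : K.link ρ) :
    Function.Injective (K.linkCoface ρ v) := by
  intro x y hxy
  have h : insert v.1 (insert x.1.1 ρ.1) = insert v.1 (insert y.1.1 ρ.1) :=
    congrArg (fun z => z.1.1) hxy
  have hx : x.1.1 ∈ insert v.1 (insert y.1.1 ρ.1) := by rw [← h]; simp
  simp only [Finset.mem_insert] at hx
  rcases hx with hx | hx | hx
  · exact absurd (Subtype.ext hx.symm) x.2.1
  · exact Subtype.ext (Subtype.ext hx)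
  · exact absurd hx (K.notMem_of_link _)

theorem linkEdge_summable (ρ : K.Simplex) (v : K.link ρ) : Summable (K.linkEdge ρ v) := by
  have h1 := (K.locallySummable ⟨insert v.1 ρ.1, v.2.2.1⟩).comp_injective
    (K.linkCoface_injective ρ v)
  have h2 : Summable ((K.linkEdge ρ v) ∘ (Subtype.val : {v' : K.link ρ // v ≠ v' ∧
      insert v.1 (insert v'.1 ρ.1) ∈ K.simplices} → K.link ρ)) := by
    refine h1.congr fun x => ?_
    exact (if_pos x.2).symm
  refine (Subtype.val_injective.summable_iff fun x hx => ?_).1 h2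
  refine if_neg fun h => hx ?_
  exact ⟨⟨x, h⟩, rfl⟩

/-- The graph `b_ρ` over the link of `ρ`. -/
def linkGraph (ρ : K.Simplex) : WGraph (K.link ρ) where
  b := K.linkEdge ρ
  nonneg v v' := by
    unfold linkEdge
    split_ifs with h
    · exact (K.m_pos _ h.2.1).le
    · exact le_rfl
  symm := K.linkEdge_symm ρ
  diag v := by simp [linkEdge]
  summable := K.linkEdge_summable ρ

/-- `(Σ, m)` is locally balanced: for every `ρ ∈ Σ`, the quotients `m(vv'ρ) / m(vv'ρ \ w)` with
`v ≠ v'` in the link of `ρ`, `vv'ρ ∈ Σ` and `w ∈ ρ` are bounded. -/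
def LocallyBalanced : Prop :=
  ∀ ρ : K.Simplex, ∃ C : ℝ, ∀ v v' : K.link ρ, v ≠ v' →
    insert v.1 (insert v'.1 ρ.1) ∈ K.simplices → ∀ w ∈ ρ.1,
      K.m (insert v.1 (insert v'.1 ρ.1)) / K.m ((insert v.1 (insert v'.1 ρ.1)).erase w) ≤ C

/-- All connected components of the graph `b_ρ` are recurrent. -/
def LinkRecurrent (ρ : K.Simplex) : Prop :=
  ∀ c : (K.linkGraph ρ).toSimpleGraph.ConnectedComponent, ((K.linkGraph ρ).component c).Recurrent

variable {K} in
open Classical in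
/-- `π^ρ u`: its value at a coface `vρ` of `ρ` is `θ(ρ, vρ) u(v)`, and it vanishes elsewhere. -/
def Coboundary.lift (d : K.Coboundary) (ρ : K.Simplex) (u : K.link ρ → ℂ) (τ : K.Simplex) : ℂ :=
  if h : ∃ v : K.link ρ, insert v.1 ρ.1 = τ.1 then u h.choose * d.θ ρ τ else 0

end Link

end WeightedComplex

end

/-!
On a connected recurrent graph, truncations of the Green functions up to time `n`, scaled to the
value `1` at a vertex, are bounded functions in `ℓ²` which tend to `1` and whose Dirichlet energies
tend to `0`. By summation by parts and the Cauchy–Schwarz inequality, a flow of finite energy with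
summable divergence on such a graph has total divergence zero.

Every `ω ∈ ℓ²` with `∂ω ∈ ℓ²` induces a flow of finite energy on the link of each simplex `ρ`,
whose value on `(v, v')` is `± ω(vv'ρ)`. Its divergence at `v` is `m(vρ) θ(ρ, vρ) ∂ω(vρ)`, so that
`m(ρ) ∂∂ω(ρ)` is its total divergence, which vanishes if all components of the link are recurrent.

On a transient component, a multiple of the Green function is a monopole `u` at a vertex `v₀`. The
flow induced by `δ π^ρ u` is the gradient of `u`, of total divergence `m(v₀ρ) ≠ 0`. Besides the
simplices `vρ`, the support of `∂ δ π^ρ u` contains only the simplices `vv'ρ \ w` with `w ∈ ρ`, and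
there local balance bounds its norm by the energy of `u`.
-/

noncomputable section

open scoped ENNReal
open Filter Topology

theorem extend_val_of_notMem {α β : Type*} [Zero β] {s : Set α} (u : s → β) {x : α}
    (hx : x ∉ s) : Function.extend Subtype.val u 0 x = 0 :=
  Function.extend_apply' _ _ _ fun ⟨y, hy⟩ => hx (hy ▸ y.2)

theorem enorm_toReal_sub_sq_add {a b : ℝ≥0∞} (ha : a ≠ ⊤) (hb : b ≠ ⊤) :
    ‖a.toReal - b.toReal‖ₑ ^ 2 + 2 * (a * b) = a ^ 2 + b ^ 2 := by
  lift a to NNReal using ha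
  lift b to NNReal using hb
  have h : ‖(a : ℝ) - b‖₊ ^ 2 + 2 * (a * b) = a ^ 2 + b ^ 2 := by
    ext
    push_cast
    rw [Real.norm_eq_abs, sq_abs]
    ring
  rw [ENNReal.coe_toReal, ENNReal.coe_toReal, enorm_eq_nnnorm]
  exact_mod_cast h

/-! ### Sums of extended nonnegative numbers -/

theorem tsum_mul_indicator_singleton {α : Type*} (f : α → ℝ≥0∞) (o : α) :
    ∑' x, f x * ({o} : Set α).indicator 1 x = f o := by
  rw [tsum_eq_single o fun x hx => by simp [hx]]
  simp

theorem tsum_le_tsum_comp_of_support_subset_range {α β : Type*} {f : β → ℝ≥0∞} {q : α → β}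
    (h : Function.support f ⊆ Set.range q) : ∑' b, f b ≤ ∑' a, f (q a) := by
  rw [← tsum_subtype_eq_of_support_subset h]
  exact ENNReal.tsum_le_tsum_comp_of_surjective Set.rangeFactorization_surjective
    (fun b : Set.range q => f b)

theorem tsum_comp_le_mul_tsum {α β : Type*} (f : β → ℝ≥0∞) {q : α → β} {n : ℕ∞}
    (hq : ∀ b, (q ⁻¹' {b}).encard ≤ n) : ∑' a, f (q a) ≤ n * ∑' b, f b := by
  rw [← ENNReal.tsum_fiberwise _ q, ← ENNReal.tsum_mul_left]
  refine ENNReal.tsum_le_tsum fun b => ?_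
  calc ∑' a : q ⁻¹' {b}, f (q a) = ∑' _ : q ⁻¹' {b}, f b :=
        tsum_congr fun a => congrArg f a.2
    _ = (q ⁻¹' {b}).encard * f b := ENNReal.tsum_set_const _ _
    _ ≤ n * f b := by gcongr; exact hq b

/-! ### Weighted square norms -/

section WeightedSqNorm

variable {ι E F : Type*} [NormedAddCommGroup E] [NormedAddCommGroup F] {w : ι → ℝ}

/-- The squared norm of `f` in `ℓ²(ι, w; E)` for a nonnegative weight `w`, as an extended
nonnegative number, so that membership in `ℓ²` means that it is not `⊤`. -/
def weightedSqNorm (w : ι → ℝ) (f : ι → E) : ℝ≥0∞ :=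
  ∑' i, ENNReal.ofReal (w i) * ‖f i‖ₑ ^ 2

theorem ofReal_mul_norm_sq {a : ℝ} (ha : 0 ≤ a) (x : E) :
    ENNReal.ofReal (a * ‖x‖ ^ 2) = ENNReal.ofReal a * ‖x‖ₑ ^ 2 := by
  rw [ENNReal.ofReal_mul ha, ENNReal.ofReal_pow (norm_nonneg x), ofReal_norm]

theorem summable_mul_norm_sq_iff (hw : ∀ i, 0 ≤ w i) (f : ι → E) :
    Summable (fun i => w i * ‖f i‖ ^ 2) ↔ weightedSqNorm w f ≠ ⊤ := by
  have h : weightedSqNorm w f = ∑' i, ENNReal.ofReal (w i * ‖f i‖ ^ 2) :=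
    tsum_congr fun i => (ofReal_mul_norm_sq (hw i) (f i)).symm
  rw [h]
  refine ⟨Summable.tsum_ofReal_ne_top, fun h => (ENNReal.summable_toReal h).congr fun i => ?_⟩
  exact ENNReal.toReal_ofReal (mul_nonneg (hw i) (sq_nonneg _))

theorem tsum_mul_enorm_mul_enorm_le (w : ι → ℝ) (f : ι → E) (g : ι → F) :
    ∑' i, ENNReal.ofReal (w i) * (‖f i‖ₑ * ‖g i‖ₑ) ≤
      weightedSqNorm w f ^ (1 / 2 : ℝ) * weightedSqNorm w g ^ (1 / 2 : ℝ) := by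
  rw [ENNReal.tsum_eq_iSup_sum]
  refine iSup_le fun s => ?_
  have h := ENNReal.inner_le_Lp_mul_Lq s
    (fun i => ENNReal.ofReal (w i) ^ (1 / 2 : ℝ) * ‖f i‖ₑ)
    (fun i => ENNReal.ofReal (w i) ^ (1 / 2 : ℝ) * ‖g i‖ₑ) Real.HolderConjugate.two_two
  have sqrt_sq (a : ℝ≥0∞) : (a ^ (1 / 2 : ℝ)) ^ 2 = a := by
    rw [← ENNReal.rpow_natCast, ← ENNReal.rpow_mul]; norm_num
  simp only [ENNReal.rpow_ofNat, mul_pow, sqrt_sq] at h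
  simp only [mul_mul_mul_comm _ ‖f _‖ₑ, ← sq, sqrt_sq] at h
  exact h.trans (by gcongr <;> exact ENNReal.sum_le_tsum s)

theorem tsum_enorm_smul_smul_le [NormedSpace ℝ F] (hw : ∀ i, 0 ≤ w i) (f : ι → ℝ) (g : ι → F) :
    ∑' i, ‖w i • f i • g i‖ₑ ≤
      weightedSqNorm w f ^ (1 / 2 : ℝ) * weightedSqNorm w g ^ (1 / 2 : ℝ) := by
  simp only [enorm_smul, Real.enorm_of_nonneg (hw _)]
  exact tsum_mul_enorm_mul_enorm_le w f g

theorem tsum_enorm_smul_smul_ne_top [NormedSpace ℝ F] (hw : ∀ i, 0 ≤ w i) {f : ι → ℝ} {g : ι → F}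
    (hf : weightedSqNorm w f ≠ ⊤) (hg : weightedSqNorm w g ≠ ⊤) :
    ∑' i, ‖w i • f i • g i‖ₑ ≠ ⊤ :=
  ne_top_of_le_ne_top (ENNReal.mul_ne_top (ENNReal.rpow_ne_top_of_nonneg (by norm_num) hf)
    (ENNReal.rpow_ne_top_of_nonneg (by norm_num) hg)) (tsum_enorm_smul_smul_le hw f g)

theorem weightedSqNorm_le_of_tendsto {α : Type*} {l : Filter α} [l.NeBot] {f : α → ι → E}
    {g : ι → E} {C : ℝ≥0∞} (hf : ∀ i, Tendsto (fun a => f a i) l (𝓝 (g i)))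
    (hC : ∀ a, weightedSqNorm w (f a) ≤ C) : weightedSqNorm w g ≤ C := by
  rw [weightedSqNorm, ENNReal.tsum_eq_iSup_sum]
  refine iSup_le fun s => ?_
  have hlim : Tendsto (fun a => ∑ i ∈ s, ENNReal.ofReal (w i) * ‖f a i‖ₑ ^ 2) l
      (𝓝 (∑ i ∈ s, ENNReal.ofReal (w i) * ‖g i‖ₑ ^ 2)) :=
    tendsto_finsetSum _ fun i _ =>
      ENNReal.Tendsto.const_mul (ENNReal.Tendsto.pow (hf i).enorm) (.inr ENNReal.ofReal_ne_top)
  exact le_of_tendsto' hlim fun a => (ENNReal.sum_le_tsum s).trans (hC a)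

end WeightedSqNorm

namespace WGraph

variable {V : Type*} (G : WGraph V)

/-! ### The transition operator of the random walk -/

/-- The weighted degree of a vertex. -/
def deg (x : V) : ℝ := ∑' y, G.b x y

theorem deg_nonneg (x : V) : 0 ≤ G.deg x := tsum_nonneg (G.nonneg x)

theorem ofReal_deg (x : V) : ENNReal.ofReal (G.deg x) = ∑' y, ENNReal.ofReal (G.b x y) :=
  ENNReal.ofReal_tsum_of_nonneg (G.nonneg x) (G.summable x)

theorem ofReal_deg_mul_step (x z : V) :
    ENNReal.ofReal (G.deg x) * G.step x z = ENNReal.ofReal (G.b x z) := by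
  by_cases h : ∑' y, ENNReal.ofReal (G.b x y) = 0
  · rw [ofReal_deg, h, zero_mul, ENNReal.tsum_eq_zero.1 h z]
  · rw [step, dif_neg h, PMF.normalize_apply, ofReal_deg, mul_comm, mul_assoc,
      ENNReal.inv_mul_cancel h (G.summable x).tsum_ofReal_ne_top, mul_one]

theorem step_ne_zero {x z : V} (h : 0 < G.b x z) : G.step x z ≠ 0 := by
  intro h0
  have h1 := G.ofReal_deg_mul_step x z
  rw [h0, mul_zero, eq_comm, ENNReal.ofReal_eq_zero] at h1
  exact h1.not_gt h

theorem step_eq_pure_of_deg_eq_zero {x : V} (h : G.deg x = 0) : G.step x = PMF.pure x := by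
  rw [step, dif_pos]
  rw [← ofReal_deg, h, ENNReal.ofReal_zero]

/-- The transition operator `P` of the random walk, acting on nonnegative functions. -/
def transition : Module.End ℝ≥0∞ (V → ℝ≥0∞) where
  toFun f x := ∑' z, G.step x z * f z
  map_add' f g := by
    ext x
    simp only [Pi.add_apply, mul_add, ENNReal.tsum_add]
  map_smul' c f := by
    ext x
    simp only [Pi.smul_apply, smul_eq_mul, RingHom.id_apply, mul_left_comm, ENNReal.tsum_mul_left]

theorem transition_apply (f : V → ℝ≥0∞) (x : V) :
    G.transition f x = ∑' z, G.step x z * f z := rfl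

theorem transition_mono {f g : V → ℝ≥0∞} (h : f ≤ g) : G.transition f ≤ G.transition g :=
  fun _ => ENNReal.tsum_le_tsum fun z => mul_le_mul_right (h z) _

theorem transition_const (c : ℝ≥0∞) : G.transition (fun _ => c) = fun _ => c := by
  ext x
  rw [transition_apply, ENNReal.tsum_mul_right, PMF.tsum_coe, one_mul]

theorem transition_tsum (f : ℕ → V → ℝ≥0∞) (x : V) :
    G.transition (fun z => ∑' n, f n z) x = ∑' n, G.transition (f n) x := by
  simp only [transition_apply, ← ENNReal.tsum_mul_left]
  exact ENNReal.tsum_comm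

theorem ofReal_deg_mul_transition (f : V → ℝ≥0∞) (x : V) :
    ENNReal.ofReal (G.deg x) * G.transition f x = ∑' z, ENNReal.ofReal (G.b x z) * f z := by
  simp only [transition_apply, ← ENNReal.tsum_mul_left, ← mul_assoc, ofReal_deg_mul_step]

theorem lintegral_step [MeasurableSpace V] [DiscreteMeasurableSpace V] (f : V → ℝ≥0∞) (x : V) :
    ∫⁻ z, f z ∂(G.step x).toMeasure = G.transition f x := by
  have h : (G.step x).toMeasure = Measure.sum fun z => G.step x z • Measure.dirac z := by
    ext s hs
    rw [PMF.toMeasure_apply _ hs, Measure.sum_apply _ hs]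
    refine tsum_congr fun z => ?_
    rw [Measure.smul_apply, Measure.dirac_apply' _ hs, smul_eq_mul]
    by_cases hz : z ∈ s <;> simp [hz]
  rw [h, lintegral_sum_measure]
  refine tsum_congr fun z => ?_
  rw [lintegral_smul_measure, lintegral_dirac' _ .of_discrete, smul_eq_mul]

theorem transition_iInf {f : ℕ → V → ℝ≥0∞} (hf : Antitone f) (h0 : f 0 ≤ 1) (x : V) :
    G.transition (⨅ n, f n) x = ⨅ n, G.transition (f n) x := by
  let _ : MeasurableSpace V := ⊤
  simp only [← lintegral_step, iInf_apply]
  refine lintegral_iInf (fun _ => .of_discrete) hf (ne_top_of_le_ne_top ENNReal.one_ne_top ?_)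
  exact (lintegral_mono h0).trans (by simp)

/-- The transition operator of the random walk killed when it enters `y`. -/
def killed (y : V) : Module.End ℝ≥0∞ (V → ℝ≥0∞) :=
  G.transition ∘ₗ LinearMap.mulLeft ℝ≥0∞ (({y}ᶜ : Set V).indicator 1)

theorem killed_apply (y : V) (f : V → ℝ≥0∞) :
    G.killed y f = G.transition (({y}ᶜ : Set V).indicator f) := by
  rw [killed, LinearMap.comp_apply, LinearMap.mulLeft_apply]
  congr 1
  ext z
  by_cases h : z = y <;> simp [h]

theorem killed_mono (y : V) {f g : V → ℝ≥0∞} (h : f ≤ g) : G.killed y f ≤ G.killed y g := by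
  simp only [killed_apply]
  exact G.transition_mono fun z => Set.indicator_le_indicator (h z)

theorem killed_le_transition (y : V) (f : V → ℝ≥0∞) : G.killed y f ≤ G.transition f := by
  rw [killed_apply]
  exact G.transition_mono (Set.indicator_le_self _ _)

theorem transition_eq_killed_add (y : V) (f : V → ℝ≥0∞) :
    G.transition f = G.killed y f + f y • G.transition (({y} : Set V).indicator 1) := by
  rw [killed_apply, ← map_smul, ← map_add]
  congr 1
  ext z
  by_cases h : z = y <;> simp [h]

/-! ### Hitting probabilities -/

/-- The probability of not visiting `y` at the times `1, …, n`, as a function of the starting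
point. -/
def avoid (y : V) (n : ℕ) : V → ℝ≥0∞ := (G.killed y ^ n) 1

/-- The probability of never visiting `y` at a positive time, as a function of the starting
point. -/
def escape (y : V) : V → ℝ≥0∞ := ⨅ n, G.avoid y n

theorem avoid_succ (y : V) (n : ℕ) : G.avoid y (n + 1) = G.killed y (G.avoid y n) := by
  rw [avoid, pow_succ', Module.End.mul_apply, avoid]

theorem avoid_antitone (y : V) : Antitone (G.avoid y) := by
  refine antitone_nat_of_succ_le fun n => ?_
  induction n with
  | zero => exact (G.killed_le_transition y 1).trans_eq (G.transition_const 1)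
  | succ n ih =>
    exact (G.avoid_succ y (n + 1)).trans_le
      ((G.killed_mono y ih).trans_eq (G.avoid_succ y n).symm)

theorem escape_le_one (y : V) : G.escape y ≤ 1 := iInf_le _ 0

theorem killed_escape (y : V) : G.killed y (G.escape y) = G.escape y := by
  have h : ({y}ᶜ : Set V).indicator (G.escape y) = ⨅ n, ({y}ᶜ : Set V).indicator (G.avoid y n) := by
    ext z
    by_cases hz : z = y <;> simp [hz, escape]
  ext x
  rw [killed_apply, h, transition_iInf]
  · simp only [← killed_apply, ← avoid_succ, escape, iInf_apply]
    exact (Antitone.iInf_nat_add (fun _ _ hmn => G.avoid_antitone y hmn x) 1)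
  · exact fun m n hmn z => Set.indicator_le_indicator (G.avoid_antitone y hmn z)
  · exact Set.indicator_le_self _ _

section Walk

variable [MeasurableSpace V] [DiscreteMeasurableSpace V]

instance (x : V) : IsProbabilityMeasure (G.walkLaw x) := by
  unfold walkLaw; infer_instance

/-- The transition kernel from the path up to time `n` to the position at time `n + 1`. -/
def pathKernel (n : ℕ) : Kernel (Finset.Iic n → V) V :=
  G.stepKernel.comap (fun h => h ⟨n, Finset.mem_Iic.2 le_rfl⟩) (measurable_pi_apply _)

instance (n : ℕ) : IsMarkovKernel (G.pathKernel n) := by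
  unfold pathKernel; infer_instance

theorem walkLaw_eq_traj (x : V) :
    G.walkLaw x = Kernel.traj (X := fun _ => V) G.pathKernel 0 (fun _ => x) := rfl

theorem walkLaw_map_frestrictLe (x : V) (n : ℕ) :
    (G.walkLaw x).map (Preorder.frestrictLe (π := fun _ => V) n) =
      Kernel.partialTraj (X := fun _ => V) G.pathKernel 0 n (fun _ => x) :=
  Kernel.traj_map_frestrictLe_apply 0 n _

theorem walkLaw_zero (x : V) : ∀ᵐ Y ∂G.walkLaw x, Y 0 = x := by
  have h : ∀ᵐ h ∂(G.walkLaw x).map (Preorder.frestrictLe (π := fun _ => V) 0),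
      h ⟨0, Finset.mem_Iic.2 le_rfl⟩ = x := by
    rw [walkLaw_map_frestrictLe, Kernel.partialTraj_self, Kernel.id_apply, ae_dirac_iff]
    exact (MeasurableSet.singleton x).preimage (measurable_pi_apply _)
  exact ae_of_ae_map (by fun_prop) h

theorem lintegral_walkLaw_succ (x : V) (n : ℕ) {F : (Finset.Iic n → V) → ℝ≥0∞}
    (hF : Measurable F) (f : V → ℝ≥0∞) :
    ∫⁻ Y, F (Preorder.frestrictLe (π := fun _ => V) n Y) * f (Y (n + 1)) ∂G.walkLaw x =
      ∫⁻ Y, F (Preorder.frestrictLe (π := fun _ => V) n Y) * G.transition f (Y n)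
        ∂G.walkLaw x := by
  have hf : Measurable f := .of_discrete
  have hPf : Measurable (G.transition f) := .of_discrete
  have hpath := Kernel.partialTraj_compProd_eq_map_traj (X := fun _ => V) (κ := G.pathKernel)
    (Nat.zero_le n) (x₀ := fun _ => x)
  calc _ = ∫⁻ p : (Finset.Iic n → V) × V, F p.1 * f p.2 ∂((G.walkLaw x).map
        (fun Y : ℕ → V => (Preorder.frestrictLe (π := fun _ => V) n Y, Y (n + 1)))) := by
        rw [lintegral_map (by fun_prop) (by fun_prop)]
    _ = ∫⁻ h, ∫⁻ z, F h * f z ∂G.pathKernel n h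
        ∂(G.walkLaw x).map (Preorder.frestrictLe (π := fun _ => V) n) := by
        rw [walkLaw_map_frestrictLe, walkLaw_eq_traj, ← hpath]
        exact Measure.lintegral_compProd (by fun_prop)
    _ = ∫⁻ h, F h * G.transition f (h ⟨n, Finset.mem_Iic.2 le_rfl⟩)
        ∂(G.walkLaw x).map (Preorder.frestrictLe (π := fun _ => V) n) := by
        refine lintegral_congr fun h => ?_
        rw [lintegral_const_mul _ hf, ← lintegral_step]
        rfl
    _ = _ := lintegral_map (hF.mul (hPf.comp (measurable_pi_apply _))) (by fun_prop)

theorem lintegral_walkLaw_prod_mul (q f : V → ℝ≥0∞) (n : ℕ) (x : V) :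
    ∫⁻ Y, (∏ k ∈ Finset.range n, q (Y (k + 1))) * f (Y n) ∂G.walkLaw x =
      ((G.transition ∘ₗ LinearMap.mulLeft ℝ≥0∞ q) ^ n) f x := by
  induction n generalizing f with
  | zero =>
    have h : ∀ᵐ Y ∂G.walkLaw x, f (Y 0) = f x := (G.walkLaw_zero x).mono fun Y hY => by rw [hY]
    simp [lintegral_congr_ae h]
  | succ n ih =>
    have hq : Measurable q := .of_discrete
    have markov := G.lintegral_walkLaw_succ x n (f := q * f)
      (F := fun h => ∏ k : Fin n, q (h ⟨k + 1, Finset.mem_Iic.2 (by omega)⟩))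
      (Finset.measurable_prod _ fun k _ => hq.comp (measurable_pi_apply _))
    rw [pow_succ, Module.End.mul_apply, ← ih]
    simp only [Finset.prod_range, Fin.prod_univ_castSucc, mul_assoc]
    exact markov

theorem walkLaw_avoid (x y : V) (n : ℕ) :
    G.walkLaw x {Y | ∀ k < n, Y (k + 1) ≠ y} = G.avoid y n x := by
  have hmeas : MeasurableSet {Y : ℕ → V | ∀ k < n, Y (k + 1) ≠ y} := by
    measurability
  rw [avoid, killed, ← lintegral_walkLaw_prod_mul, ← lintegral_indicator_one hmeas]
  refine lintegral_congr fun Y => ?_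
  classical
  simp only [Set.indicator_apply, Pi.one_apply, mul_one, Finset.prod_ite_zero, Finset.mem_range,
    Set.mem_compl_singleton_iff, Set.mem_ofPred_eq, Finset.prod_const_one]

theorem walkLaw_hit_eq_one_iff (x y : V) :
    G.walkLaw x {Y | ∃ k : ℕ, 0 < k ∧ Y k = y} = 1 ↔ G.escape y x = 0 := by
  have hhit : {Y : ℕ → V | ∃ k : ℕ, 0 < k ∧ Y k = y} =
      (⋂ n, {Y : ℕ → V | ∀ k < n, Y (k + 1) ≠ y})ᶜ := by
    ext Y
    simp only [Set.mem_compl_iff, Set.mem_iInter, Set.mem_ofPred_eq, not_forall, not_not]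
    constructor
    · rintro ⟨k, hk, h⟩
      exact ⟨k, k - 1, Nat.sub_one_lt hk.ne', by rwa [Nat.sub_one_add_one hk.ne']⟩
    · rintro ⟨-, k, -, h⟩
      exact ⟨k + 1, k.succ_pos, h⟩
  have hmeas (n : ℕ) : MeasurableSet {Y : ℕ → V | ∀ k < n, Y (k + 1) ≠ y} := by measurability
  rw [hhit, prob_compl_eq_one_iff (.iInter hmeas), Antitone.measure_iInter _
    (fun n => (hmeas n).nullMeasurableSet) ⟨0, measure_ne_top _ _⟩]
  · simp only [walkLaw_avoid, escape, iInf_apply]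
  · exact fun m n hmn Y hY k hk => hY k (hk.trans_le hmn)

end Walk

theorem recurrent_iff : G.Recurrent ↔ ∀ x y, G.escape y x = 0 := by
  let _ : MeasurableSpace V := ⊤
  exact forall₂_congr G.walkLaw_hit_eq_one_iff

/-! ### The Green function -/

variable {G} in
theorem forall_of_preconnected (hG : G.toSimpleGraph.Preconnected) {p : V → Prop}
    (hp : ∀ x z, 0 < G.b x z → p x → p z) {x : V} (hx : p x) (z : V) : p z := by
  obtain ⟨walk⟩ := hG x z
  induction walk with
  | nil => exact hx
  | cons h _ ih => exact ih (hp _ _ h hx)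

/-- The expected number of visits to `o` at the times `0, …, N - 1`, as a function of the starting
point. -/
def greenUpTo (o : V) (N : ℕ) : V → ℝ≥0∞ :=
  ∑ n ∈ Finset.range N, (G.transition ^ n) (({o} : Set V).indicator 1)

/-- The Green function: the expected number of visits to `o`, as a function of the starting
point. -/
def green (o x : V) : ℝ≥0∞ := ∑' n, (G.transition ^ n) (({o} : Set V).indicator 1) x

theorem greenUpTo_succ (o : V) (N : ℕ) :
    G.greenUpTo o (N + 1) = ({o} : Set V).indicator 1 + G.transition (G.greenUpTo o N) := by
  simp only [greenUpTo, Finset.sum_range_succ', map_sum, pow_succ', Module.End.mul_apply,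
    pow_zero, Module.End.one_apply, add_comm]

theorem greenUpTo_mono (o : V) : Monotone (G.greenUpTo o) :=
  monotone_nat_of_le_succ fun N x => by
    rw [greenUpTo, greenUpTo, Finset.sum_range_succ]
    exact le_self_add

theorem greenUpTo_le_natCast (o : V) (N : ℕ) (x : V) : G.greenUpTo o N x ≤ N := by
  induction N generalizing x with
  | zero => simp [greenUpTo]
  | succ N ih =>
    have h : G.transition (G.greenUpTo o N) x ≤ N :=
      (G.transition_mono (g := fun _ => N) ih x).trans_eq (by rw [transition_const])
    rw [greenUpTo_succ, Pi.add_apply, Nat.cast_succ, add_comm]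
    exact add_le_add h (Set.indicator_le_self _ _ x)

theorem greenUpTo_ne_top (o : V) (N : ℕ) (x : V) : G.greenUpTo o N x ≠ ⊤ :=
  ne_top_of_le_ne_top (ENNReal.natCast_ne_top N) (G.greenUpTo_le_natCast o N x)

theorem one_le_greenUpTo_succ_self (o : V) (N : ℕ) : 1 ≤ G.greenUpTo o (N + 1) o := by
  simp [greenUpTo_succ]

theorem greenUpTo_apply (o : V) (N : ℕ) (x : V) : G.greenUpTo o N x =
    ∑ n ∈ Finset.range N, (G.transition ^ n) (({o} : Set V).indicator 1) x :=
  Finset.sum_apply _ _ _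

theorem greenUpTo_le_green (o : V) (N : ℕ) (x : V) : G.greenUpTo o N x ≤ G.green o x :=
  (G.greenUpTo_apply o N x).trans_le (ENNReal.sum_le_tsum _)

theorem tendsto_greenUpTo (o x : V) :
    Tendsto (fun N => G.greenUpTo o N x) atTop (𝓝 (G.green o x)) := by
  simp only [greenUpTo_apply]
  exact ENNReal.summable.hasSum.tendsto_sum_nat

theorem green_eq (o : V) :
    G.green o = ({o} : Set V).indicator 1 + G.transition (G.green o) := by
  ext x
  unfold green
  rw [Pi.add_apply, transition_tsum, tsum_eq_zero_add' ENNReal.summable]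
  simp only [pow_succ', Module.End.mul_apply, pow_zero, Module.End.one_apply]

theorem green_self (o : V) : G.green o o = 1 + G.transition (G.green o) o := by
  conv_lhs => rw [green_eq]
  simp

theorem transition_green_le (o : V) : G.transition (G.green o) ≤ G.green o := by
  conv_rhs => rw [green_eq]
  exact le_add_self

theorem le_add_mul_avoid {f : V → ℝ≥0∞} (hf : G.transition f ≤ f) (o : V) (n : ℕ) :
    (fun _ => f o) ≤ f + f o • G.avoid o n := by
  induction n with
  | zero => exact fun x => (le_add_self (a := f o) (b := f x)).trans_eq (by simp [avoid])
  | succ n ih =>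
    calc (fun _ => f o) = G.transition fun _ => f o := (G.transition_const _).symm
      _ = G.killed o (fun _ => f o) + f o • G.transition (({o} : Set V).indicator 1) :=
        G.transition_eq_killed_add o _
      _ ≤ G.killed o (f + f o • G.avoid o n) + f o • G.transition (({o} : Set V).indicator 1) :=
        add_le_add_left (G.killed_mono o ih) _
      _ = G.transition f + f o • G.avoid o (n + 1) := by
        rw [map_add, map_smul, G.transition_eq_killed_add o f, avoid_succ, add_right_comm]
      _ ≤ f + f o • G.avoid o (n + 1) := add_le_add_left hf _

variable {G} in
theorem Recurrent.le_of_transition_le (h : G.Recurrent) {f : V → ℝ≥0∞} (hf : G.transition f ≤ f)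
    {o : V} (ho : f o ≠ ⊤) (x : V) : f o ≤ f x := by
  have hle : f o ≤ ⨅ n, (f x + f o * G.avoid o n x) :=
    le_iInf fun n => G.le_add_mul_avoid hf o n x
  have hescape : ⨅ n, G.avoid o n x = 0 := by
    rw [← iInf_apply]
    exact G.recurrent_iff.1 h x o
  rwa [← ENNReal.add_iInf, ← ENNReal.mul_iInf fun h => absurd h ho, hescape, mul_zero,
    add_zero] at hle

variable {G} in
theorem Recurrent.green_self_eq_top (h : G.Recurrent) (o : V) : G.green o o = ⊤ := by
  by_contra htop
  have hle : G.green o o ≤ G.transition (G.green o) o := by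
    have hconst : (fun _ => G.green o o) ≤ G.green o :=
      h.le_of_transition_le (G.transition_green_le o) htop
    simpa only [transition_const] using G.transition_mono hconst o
  have hlt : G.green o o < G.green o o + 1 := ENNReal.lt_add_right htop one_ne_zero
  refine hlt.not_ge ?_
  conv_rhs => rw [green_self, add_comm]
  gcongr

theorem mul_green_le_one {h : V → ℝ≥0∞} {c : ℝ≥0∞} {o : V} (h1 : h ≤ 1)
    (hc : h + c • ({o} : Set V).indicator 1 ≤ G.transition h) (x : V) : c * G.green o x ≤ 1 := by
  have bound (N : ℕ) : h + c • G.greenUpTo o N ≤ 1 := by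
    induction N with
    | zero => simpa [greenUpTo] using h1
    | succ N ih =>
      calc h + c • G.greenUpTo o (N + 1)
          = (h + c • ({o} : Set V).indicator 1) + c • G.transition (G.greenUpTo o N) := by
            rw [greenUpTo_succ, smul_add, add_assoc]
        _ ≤ G.transition h + c • G.transition (G.greenUpTo o N) := add_le_add_left hc _
        _ = G.transition (h + c • G.greenUpTo o N) := by rw [map_add, map_smul]
        _ ≤ G.transition 1 := G.transition_mono ih
        _ = 1 := G.transition_const 1
  rw [green, ENNReal.tsum_eq_iSup_nat, ENNReal.mul_iSup]
  refine iSup_le fun N => ?_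
  rw [← greenUpTo_apply]
  exact le_add_self.trans (bound N x)

theorem exists_escape_self_ne_zero (hG : G.toSimpleGraph.Preconnected) (h : ¬ G.Recurrent) :
    ∃ o, G.escape o o ≠ 0 := by
  rw [recurrent_iff] at h
  push Not at h
  obtain ⟨x, o, hx⟩ := h
  refine ⟨o, fun h0 => hx (forall_of_preconnected hG (p := fun x => G.escape o x = 0) ?_ h0 x)⟩
  intro x z hb hx
  by_cases hz : z = o
  · rwa [hz]
  · rw [← killed_escape, killed_apply, transition_apply] at hx
    simpa [G.step_ne_zero hb, hz] using ENNReal.tsum_eq_zero.1 hx z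

theorem exists_green_self_ne_top (hG : G.toSimpleGraph.Preconnected) (h : ¬ G.Recurrent) :
    ∃ o, G.green o o ≠ ⊤ := by
  obtain ⟨o, ho⟩ := G.exists_escape_self_ne_zero hG h
  refine ⟨o, fun htop => ?_⟩
  have hle : G.escape o o * G.green o o ≤ 1 := by
    refine G.mul_green_le_one (h := ({o}ᶜ : Set V).indicator (G.escape o))
      ((Set.indicator_le_self _ _).trans (G.escape_le_one o)) ?_ o
    rw [← killed_apply, killed_escape]
    intro x
    by_cases hx : x = o <;> simp [hx]
  rw [htop, ENNReal.mul_top ho] at hle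
  exact hle.not_gt ENNReal.one_lt_top

theorem deg_pos_of_green_self_ne_top {o : V} (h : G.green o o ≠ ⊤) : 0 < G.deg o := by
  refine (G.deg_nonneg o).lt_of_ne' fun h0 => ?_
  have htrans : G.transition (G.green o) o = G.green o o := by
    rw [transition_apply, G.step_eq_pure_of_deg_eq_zero h0,
      tsum_eq_single o fun z hz => by simp [hz]]
    simp
  have hlt : G.green o o < G.green o o + 1 := ENNReal.lt_add_right h one_ne_zero
  refine hlt.ne ?_
  conv_lhs => rw [green_self, htrans, add_comm]

theorem green_ne_top (hG : G.toSimpleGraph.Preconnected) {o : V} (h : G.green o o ≠ ⊤) (x : V) :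
    G.green o x ≠ ⊤ := by
  refine forall_of_preconnected hG (p := fun x => G.green o x ≠ ⊤) (fun x z hb hx hz => hx ?_) h x
  have htop : G.transition (G.green o) x = ⊤ :=
    ENNReal.tsum_eq_top_of_eq_top ⟨z, by rw [hz, ENNReal.mul_top (G.step_ne_zero hb)]⟩
  exact top_unique (htop.symm.trans_le (G.transition_green_le o x))

/-! ### Energy -/

section Energy

variable {E F : Type*} [NormedAddCommGroup E] [NormedAddCommGroup F]

/-- The discrete gradient of `u`, with value `u x - u y` on the oriented edge `(x, y)`. -/
def grad (u : V → E) (x y : V) : E := u x - u y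

/-- The energy of `φ`, a function on oriented edges, where each edge counts with both
orientations. -/
def energy (φ : V → V → E) : ℝ≥0∞ :=
  weightedSqNorm (fun p : V × V => G.b p.1 p.2) fun p => φ p.1 p.2

theorem mem_finiteEnergy_iff (u : V → ℂ) : u ∈ G.finiteEnergy ↔ G.energy (grad u) ≠ ⊤ :=
  summable_mul_norm_sq_iff (fun _ => G.nonneg _ _) _

theorem energy_eq_tsum_tsum (φ : V → V → E) :
    G.energy φ = ∑' x, ∑' y, ENNReal.ofReal (G.b x y) * ‖φ x y‖ₑ ^ 2 :=
  ENNReal.tsum_prod (f := fun x y => ENNReal.ofReal (G.b x y) * ‖φ x y‖ₑ ^ 2)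

theorem mul_enorm_sq_le_energy (φ : V → V → E) (x y : V) :
    ENNReal.ofReal (G.b x y) * ‖φ x y‖ₑ ^ 2 ≤ G.energy φ :=
  ENNReal.le_tsum (f := fun p : V × V => ENNReal.ofReal (G.b p.1 p.2) * ‖φ p.1 p.2‖ₑ ^ 2) (x, y)

theorem energy_grad_comp_le {K : NNReal} {f : E → F} (hf : LipschitzWith K f) (u : V → E) :
    G.energy (grad (f ∘ u)) ≤ K ^ 2 * G.energy (grad u) := by
  rw [energy, energy, weightedSqNorm, weightedSqNorm, ← ENNReal.tsum_mul_left]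
  refine ENNReal.tsum_le_tsum fun p => ?_
  have h : ‖f (u p.1) - f (u p.2)‖ₑ ≤ K * ‖u p.1 - u p.2‖ₑ := by
    simpa only [edist_eq_enorm_sub] using hf (u p.1) (u p.2)
  calc _ ≤ ENNReal.ofReal (G.b p.1 p.2) * (K * ‖u p.1 - u p.2‖ₑ) ^ 2 := by gcongr; exact h
    _ = _ := by rw [mul_pow, mul_left_comm]; rfl

theorem energy_grad_le_of_tendsto {u : ℕ → V → E} {v : V → E} {C : ℝ≥0∞}
    (hu : ∀ x, Tendsto (fun n => u n x) atTop (𝓝 (v x)))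
    (hC : ∀ n, G.energy (grad (u n)) ≤ C) : G.energy (grad v) ≤ C :=
  weightedSqNorm_le_of_tendsto (fun p => (hu p.1).sub (hu p.2)) hC

end Energy

theorem tsum_deg_mul_transition (f : V → ℝ≥0∞) :
    ∑' x, ENNReal.ofReal (G.deg x) * G.transition f x = ∑' x, ENNReal.ofReal (G.deg x) * f x := by
  simp only [ofReal_deg_mul_transition]
  simp only [ofReal_deg, ← ENNReal.tsum_mul_right]
  rw [ENNReal.tsum_comm]
  simp only [G.symm]

theorem tsum_deg_mul_greenUpTo (o : V) (N : ℕ) :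
    ∑' x, ENNReal.ofReal (G.deg x) * G.greenUpTo o N x = N * ENNReal.ofReal (G.deg o) := by
  induction N with
  | zero => simp [greenUpTo]
  | succ N ih =>
    simp only [greenUpTo_succ, Pi.add_apply, mul_add, ENNReal.tsum_add, tsum_deg_mul_transition,
      tsum_mul_indicator_singleton, ih]
    rw [Nat.cast_succ, add_mul, one_mul, add_comm]

theorem energy_grad_toReal_add {g : V → ℝ≥0∞} (hg : ∀ x, g x ≠ ⊤) :
    G.energy (grad fun x => (g x).toReal) +
        2 * ∑' x, ENNReal.ofReal (G.deg x) * (g x * G.transition g x) =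
      2 * ∑' x, ENNReal.ofReal (G.deg x) * g x ^ 2 := by
  have hcross : ∑' x, ENNReal.ofReal (G.deg x) * (g x * G.transition g x) =
      ∑' x, ∑' z, ENNReal.ofReal (G.b x z) * (g x * g z) := by
    simp only [mul_left_comm _ (g _), ofReal_deg_mul_transition, ENNReal.tsum_mul_left]
  have hfst : ∑' x, ENNReal.ofReal (G.deg x) * g x ^ 2 =
      ∑' x, ∑' z, ENNReal.ofReal (G.b x z) * g x ^ 2 := by
    simp only [ofReal_deg, ENNReal.tsum_mul_right]
  have hsnd : ∑' x, ENNReal.ofReal (G.deg x) * g x ^ 2 =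
      ∑' x, ∑' z, ENNReal.ofReal (G.b x z) * g z ^ 2 := by
    rw [hfst, ENNReal.tsum_comm]
    simp only [G.symm]
  rw [two_mul (∑' x, ENNReal.ofReal (G.deg x) * g x ^ 2)]
  nth_rw 1 [hfst]
  rw [hsnd, hcross, energy_eq_tsum_tsum]
  simp only [← ENNReal.tsum_mul_left, ← ENNReal.tsum_add, grad, ← mul_add,
    ← enorm_toReal_sub_sq_add (hg _) (hg _), mul_left_comm (2 : ℝ≥0∞)]

theorem energy_grad_toReal_le {g : V → ℝ≥0∞} {o : V} (hg : ∀ x, g x ≠ ⊤)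
    (hle : g ≤ G.transition g + ({o} : Set V).indicator 1)
    (hfin : ∑' x, ENNReal.ofReal (G.deg x) * (g x * G.transition g x) ≠ ⊤) :
    G.energy (grad fun x => (g x).toReal) ≤ 2 * (ENNReal.ofReal (G.deg o) * g o) := by
  have hsq : ∑' x, ENNReal.ofReal (G.deg x) * g x ^ 2 ≤
      ENNReal.ofReal (G.deg o) * g o +
        ∑' x, ENNReal.ofReal (G.deg x) * (g x * G.transition g x) := by
    rw [← tsum_mul_indicator_singleton (fun x => ENNReal.ofReal (G.deg x) * g x) o, add_comm,
      ← ENNReal.tsum_add]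
    refine ENNReal.tsum_le_tsum fun x => ?_
    rw [mul_assoc, ← mul_add, ← mul_add, sq]
    gcongr
    exact hle x
  rw [← ENNReal.add_le_add_iff_right (ENNReal.mul_ne_top (ENNReal.ofNat_ne_top (n := 2)) hfin),
    G.energy_grad_toReal_add hg, ← mul_add]
  gcongr

theorem energy_grad_greenUpTo_le (o : V) (N : ℕ) :
    G.energy (grad fun x => (G.greenUpTo o N x).toReal) ≤
      2 * (ENNReal.ofReal (G.deg o) * G.greenUpTo o N o) := by
  refine G.energy_grad_toReal_le (G.greenUpTo_ne_top o N) ?_ ?_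
  · rw [add_comm, ← greenUpTo_succ]
    exact G.greenUpTo_mono o N.le_succ
  · have hle : ∑' x, ENNReal.ofReal (G.deg x) *
        (G.greenUpTo o N x * G.transition (G.greenUpTo o N) x) ≤
          N * (N * ENNReal.ofReal (G.deg o)) := by
      rw [← tsum_deg_mul_greenUpTo, ← G.tsum_deg_mul_transition (G.greenUpTo o N),
        ← ENNReal.tsum_mul_left]
      refine ENNReal.tsum_le_tsum fun x => ?_
      rw [mul_left_comm]
      gcongr
      exact G.greenUpTo_le_natCast o N x
    exact ne_top_of_le_ne_top (by finiteness) hle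

theorem energy_grad_green_ne_top {o : V} (hfin : ∀ x, G.green o x ≠ ⊤) :
    G.energy (grad fun x => (G.green o x).toReal) ≠ ⊤ := by
  have hle : G.energy (grad fun x => (G.green o x).toReal) ≤
      2 * (ENNReal.ofReal (G.deg o) * G.green o o) := by
    refine G.energy_grad_le_of_tendsto
      (fun x => (ENNReal.tendsto_toReal (hfin x)).comp (G.tendsto_greenUpTo o x)) fun N => ?_
    refine (G.energy_grad_greenUpTo_le o N).trans ?_
    gcongr
    exact G.greenUpTo_le_green o N o
  have := hfin o
  exact ne_top_of_le_ne_top (by finiteness) hle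

/-! ### Flows on recurrent graphs -/

/-- A sequence `e n` of bounded functions in `ℓ²` with `e n → 1` pointwise whose energies tend to
`0`. Such sequences witness the recurrence of a connected graph. -/
structure IsNullSequence (e : ℕ → V → ℝ) : Prop where
  norm_le_one : ∀ n x, ‖e n x‖ ≤ 1
  weightedSqNorm_ne_top : ∀ n, weightedSqNorm G.deg (e n) ≠ ⊤
  tendsto_energy : Tendsto (fun n => G.energy (grad (e n))) atTop (𝓝 0)
  tendsto_one : ∀ x, Tendsto (fun n => e n x) atTop (𝓝 1)

section Flow

variable {E : Type*} [NormedAddCommGroup E]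

variable {G} in
theorem tendsto_of_tendsto_energy (hG : G.toSimpleGraph.Preconnected) {α : Type*} {l : Filter α}
    {u : α → V → E} (hu : Tendsto (fun a => G.energy (grad (u a))) l (𝓝 0)) {o : V} {c : E}
    (ho : Tendsto (fun a => u a o) l (𝓝 c)) (x : V) : Tendsto (fun a => u a x) l (𝓝 c) := by
  refine forall_of_preconnected hG (p := fun x => Tendsto (fun a => u a x) l (𝓝 c))
    (fun x z hb hx => ?_) ho x
  have hsq : Tendsto (fun a => ENNReal.ofReal (G.b x z) * ‖grad (u a) x z‖ₑ ^ 2) l (𝓝 0) :=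
    tendsto_of_tendsto_of_tendsto_of_le_of_le tendsto_const_nhds hu (fun _ => zero_le)
      fun a => G.mul_enorm_sq_le_energy _ x z
  have hgrad : Tendsto (fun a => grad (u a) x z) l (𝓝 0) := by
    have h := ENNReal.Tendsto.const_mul (a := (ENNReal.ofReal (G.b x z))⁻¹) hsq
      (.inr (by simpa using hb))
    simp only [← mul_assoc, mul_zero,
      ENNReal.inv_mul_cancel (ENNReal.ofReal_pos.2 hb).ne' ENNReal.ofReal_ne_top, one_mul] at h
    have hsqrt (s : ℝ≥0∞) : (s ^ 2) ^ (1 / 2 : ℝ) = s := by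
      rw [← ENNReal.rpow_natCast, ← ENNReal.rpow_mul]; norm_num
    rw [tendsto_zero_iff_enorm_tendsto_zero]
    simpa only [hsqrt, ENNReal.zero_rpow_of_pos one_half_pos] using h.ennrpow_const (1 / 2)
  simpa [grad] using hx.sub hgrad

/-- The Green function up to time `N`, scaled to the value `1` at `o` and truncated at `1`. -/
def normalizedGreen (o : V) (N : ℕ) (x : V) : ℝ :=
  min ((G.greenUpTo o N x).toReal / (G.greenUpTo o N o).toReal) 1

theorem normalizedGreen_nonneg (o : V) (N : ℕ) (x : V) : 0 ≤ G.normalizedGreen o N x :=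
  le_min (div_nonneg ENNReal.toReal_nonneg ENNReal.toReal_nonneg) zero_le_one

theorem one_le_toReal_greenUpTo_succ_self (o : V) (N : ℕ) :
    1 ≤ (G.greenUpTo o (N + 1) o).toReal :=
  ENNReal.toReal_mono (G.greenUpTo_ne_top o _ o) (G.one_le_greenUpTo_succ_self o N)

theorem energy_grad_normalizedGreen_le (o : V) (N : ℕ) :
    G.energy (grad (G.normalizedGreen o (N + 1))) ≤
      2 * ENNReal.ofReal (G.deg o) * (G.greenUpTo o (N + 1) o)⁻¹ := by
  have htop := G.greenUpTo_ne_top o (N + 1) o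
  have hzero : G.greenUpTo o (N + 1) o ≠ 0 :=
    (one_pos.trans_le (G.one_le_greenUpTo_succ_self o N)).ne'
  set c := G.greenUpTo o (N + 1) o
  have hlip : LipschitzWith c.toNNReal⁻¹ fun t : ℝ => min (t / c.toReal) 1 := by
    refine LipschitzWith.min_const ?_ 1
    refine LipschitzWith.of_dist_le_mul fun s t => ?_
    rw [Real.dist_eq, Real.dist_eq, ← sub_div, abs_div, abs_of_nonneg ENNReal.toReal_nonneg,
      div_eq_inv_mul]
    rfl
  calc G.energy (grad (G.normalizedGreen o (N + 1)))
      ≤ (c.toNNReal⁻¹ : NNReal) ^ 2 * (2 * (ENNReal.ofReal (G.deg o) * c)) :=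
        (G.energy_grad_comp_le hlip _).trans (by gcongr; exact G.energy_grad_greenUpTo_le o _)
    _ = 2 * ENNReal.ofReal (G.deg o) * c⁻¹ * (c⁻¹ * c) := by
        rw [ENNReal.coe_inv (ENNReal.toNNReal_ne_zero.2 ⟨hzero, htop⟩), ENNReal.coe_toNNReal htop]
        ring
    _ = 2 * ENNReal.ofReal (G.deg o) * c⁻¹ := by rw [ENNReal.inv_mul_cancel hzero htop, mul_one]

theorem weightedSqNorm_normalizedGreen_ne_top (o : V) (N : ℕ) :
    weightedSqNorm G.deg (G.normalizedGreen o (N + 1)) ≠ ⊤ := by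
  have hle : weightedSqNorm G.deg (G.normalizedGreen o (N + 1)) ≤
      ∑' x, ENNReal.ofReal (G.deg x) * G.greenUpTo o (N + 1) x := by
    refine ENNReal.tsum_le_tsum fun x => ?_
    gcongr
    have hnonneg := G.normalizedGreen_nonneg o (N + 1) x
    rw [Real.enorm_of_nonneg hnonneg, ← ENNReal.ofReal_pow hnonneg]
    refine ENNReal.ofReal_le_of_le_toReal ?_
    calc G.normalizedGreen o (N + 1) x ^ 2 ≤ G.normalizedGreen o (N + 1) x :=
          pow_le_of_le_one hnonneg (min_le_right _ _) two_ne_zero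
      _ ≤ (G.greenUpTo o (N + 1) x).toReal :=
          (min_le_left _ _).trans
            (div_le_self ENNReal.toReal_nonneg (G.one_le_toReal_greenUpTo_succ_self o N))
  refine ne_top_of_le_ne_top ?_ hle
  rw [tsum_deg_mul_greenUpTo]
  finiteness

variable {G} in
theorem isNullSequence_normalizedGreen (hG : G.toSimpleGraph.Preconnected) {o : V}
    (ho : G.green o o = ⊤) : G.IsNullSequence fun N => G.normalizedGreen o (N + 1) := by
  have henergy : Tendsto (fun N => G.energy (grad (G.normalizedGreen o (N + 1)))) atTop (𝓝 0) := by
    have hinv : Tendsto (fun N => (G.greenUpTo o (N + 1) o)⁻¹) atTop (𝓝 0) := by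
      rw [← ENNReal.inv_top, ← ho]
      exact ((G.tendsto_greenUpTo o o).comp (tendsto_add_atTop_nat 1)).inv
    have hbound := ENNReal.Tendsto.const_mul (a := 2 * ENNReal.ofReal (G.deg o)) hinv
      (.inr (by finiteness))
    rw [mul_zero] at hbound
    exact tendsto_of_tendsto_of_tendsto_of_le_of_le tendsto_const_nhds hbound
      (fun _ => zero_le) (G.energy_grad_normalizedGreen_le o)
  refine ⟨fun N x => ?_, G.weightedSqNorm_normalizedGreen_ne_top o, henergy,
    tendsto_of_tendsto_energy hG henergy (o := o) (tendsto_const_nhds.congr fun N => ?_)⟩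
  · rw [Real.norm_of_nonneg (G.normalizedGreen_nonneg o _ x)]
    exact min_le_right _ _
  · have hpos := one_pos.trans_le (G.one_le_toReal_greenUpTo_succ_self o N)
    rw [normalizedGreen, div_self hpos.ne', min_self]

theorem weightedSqNorm_comp_fst (f : V → E) :
    weightedSqNorm (fun p : V × V => G.b p.1 p.2) (fun p => f p.1) = weightedSqNorm G.deg f := by
  rw [weightedSqNorm, ENNReal.tsum_prod (f := fun x y => ENNReal.ofReal (G.b x y) * ‖f x‖ₑ ^ 2)]
  simp only [ENNReal.tsum_mul_right, ← ofReal_deg, weightedSqNorm]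

variable [NormedSpace ℝ E]

/-- The net flow out of each vertex for a function `φ` on oriented edges. -/
def divergence (φ : V → V → E) (x : V) : E := ∑' y, G.b x y • φ x y

theorem laplacian_eq (μ : V → ℝ) (u : V → ℂ) (x : V) :
    G.laplacian μ u x = (1 / (μ x : ℂ)) * G.divergence (grad u) x := by
  simp only [laplacian, divergence, grad, Complex.real_smul]

variable [CompleteSpace E] {e : V → ℝ} {φ : V → V → E}

variable {G} in
theorem summable_smul_flow (he : weightedSqNorm G.deg e ≠ ⊤) (hφ : G.energy φ ≠ ⊤) :
    Summable fun p : V × V => G.b p.1 p.2 • e p.1 • φ p.1 p.2 :=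
  .of_enorm (tsum_enorm_smul_smul_ne_top (w := fun p : V × V => G.b p.1 p.2)
    (fun _ => G.nonneg _ _) (by rwa [weightedSqNorm_comp_fst]) hφ)

variable {G} in
theorem tsum_smul_divergence (he : weightedSqNorm G.deg e ≠ ⊤) (hφ : G.energy φ ≠ ⊤) :
    ∑' x, e x • G.divergence φ x = ∑' p : V × V, G.b p.1 p.2 • e p.1 • φ p.1 p.2 := by
  rw [(summable_smul_flow he hφ).tsum_prod]
  refine tsum_congr fun x => ?_
  rw [divergence, ← tsum_const_smul'']
  simp only [smul_comm (e x)]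

variable {G} in
theorem two_smul_tsum_smul_divergence (he : weightedSqNorm G.deg e ≠ ⊤) (hφ : G.energy φ ≠ ⊤)
    (hanti : ∀ x y, φ y x = -φ x y) : (2 : ℝ) • ∑' x, e x • G.divergence φ x =
      ∑' p : V × V, G.b p.1 p.2 • grad e p.1 p.2 • φ p.1 p.2 := by
  have hs := summable_smul_flow he hφ
  have hswap : (fun p : V × V => G.b p.1 p.2 • e p.2 • φ p.1 p.2) =
      fun p => -((fun q : V × V => G.b q.1 q.2 • e q.1 • φ q.1 q.2) (Equiv.prodComm V V p)) := by
    ext p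
    simp only [Equiv.prodComm_apply, Prod.fst_swap, Prod.snd_swap, G.symm p.2, hanti p.1 p.2,
      smul_neg, neg_neg]
  have hs' := ((Equiv.prodComm V V).summable_iff.2 hs).neg
  simp only [grad, sub_smul, smul_sub]
  rw [hs.tsum_sub (by rw [hswap]; exact hs'), hswap, tsum_neg,
    (Equiv.prodComm V V).tsum_eq fun q : V × V => G.b q.1 q.2 • e q.1 • φ q.1 q.2,
    sub_neg_eq_add, ← two_smul ℝ, tsum_smul_divergence he hφ]

variable {G} in
theorem IsNullSequence.tsum_divergence_eq_zero {e : ℕ → V → ℝ} (he : G.IsNullSequence e)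
    (hanti : ∀ x y, φ y x = -φ x y) (hφ : G.energy φ ≠ ⊤)
    (hdiv : Summable fun x => ‖G.divergence φ x‖) : ∑' x, G.divergence φ x = 0 := by
  have hlim : Tendsto (fun n => (2 : ℝ) • ∑' x, e n x • G.divergence φ x) atTop
      (𝓝 ((2 : ℝ) • ∑' x, G.divergence φ x)) := by
    refine (tendsto_tsum_of_dominated_convergence hdiv (fun x => ?_) (.of_forall ?_)).const_smul _
    · simpa using (he.tendsto_one x).smul_const (G.divergence φ x)
    · intro n x
      rw [norm_smul]
      exact mul_le_of_le_one_left (norm_nonneg _) (he.norm_le_one n x)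
  have hbound (n : ℕ) : ‖(2 : ℝ) • ∑' x, e n x • G.divergence φ x‖ₑ ≤
      G.energy (grad (e n)) ^ (1 / 2 : ℝ) * G.energy φ ^ (1 / 2 : ℝ) := by
    rw [two_smul_tsum_smul_divergence (he.weightedSqNorm_ne_top n) hφ hanti]
    exact enorm_tsum_le_tsum_enorm.trans
      (tsum_enorm_smul_smul_le (fun p : V × V => G.nonneg p.1 p.2) _ _)
  have hzero : Tendsto (fun n => G.energy (grad (e n)) ^ (1 / 2 : ℝ) * G.energy φ ^ (1 / 2 : ℝ))
      atTop (𝓝 0) := by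
    have h := ENNReal.Tendsto.mul_const (b := G.energy φ ^ (1 / 2 : ℝ))
      (he.tendsto_energy.ennrpow_const (1 / 2))
      (.inr (ENNReal.rpow_ne_top_of_nonneg (by norm_num) hφ))
    rwa [ENNReal.zero_rpow_of_pos (by norm_num), zero_mul] at h
  have h0 := tendsto_nhds_unique hlim (tendsto_zero_iff_enorm_tendsto_zero.2
    (tendsto_of_tendsto_of_tendsto_of_le_of_le tendsto_const_nhds hzero (fun _ => zero_le)
      hbound))
  exact (smul_eq_zero.1 h0).resolve_left two_ne_zero

end Flow

section Component

variable {E : Type*} [NormedAddCommGroup E] (c : G.toSimpleGraph.ConnectedComponent)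

theorem component_preconnected : (G.component c).toSimpleGraph.Preconnected :=
  c.connected_toSimpleGraph.preconnected

variable {G c} in
theorem b_eq_zero_of_notMem_supp {x z : V} (hx : x ∈ c.supp) (hz : z ∉ c.supp) : G.b x z = 0 := by
  by_contra h
  have hadj : G.toSimpleGraph.Adj x z := (G.nonneg x z).lt_of_ne' h
  exact hz ((c.mem_supp_congr_adj hadj).1 hx)

theorem divergence_component [NormedSpace ℝ E] (φ : V → V → E) (x : c.supp) :
    (G.component c).divergence (fun x z => φ x z) x = G.divergence φ x :=
  tsum_subtype_eq_of_support_subset (f := fun z => G.b x z • φ x z) fun z hz => by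
    by_contra h
    exact hz (by simp only [b_eq_zero_of_notMem_supp x.2 h, zero_smul])

theorem energy_component_le (φ : V → V → E) :
    (G.component c).energy (fun x z => φ x z) ≤ G.energy φ :=
  ENNReal.tsum_comp_le_tsum_of_injective
    (Subtype.val_injective.prodMap Subtype.val_injective) _

variable {G} in
theorem tsum_divergence_eq_zero [NormedSpace ℝ E] [CompleteSpace E]
    (hrec : ∀ c : G.toSimpleGraph.ConnectedComponent, (G.component c).Recurrent) {φ : V → V → E}
    (hanti : ∀ x y, φ y x = -φ x y) (hφ : G.energy φ ≠ ⊤)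
    (hdiv : Summable fun x => ‖G.divergence φ x‖) : ∑' x, G.divergence φ x = 0 := by
  rw [← (hdiv.of_norm.hasSum.tsum_fiberwise G.toSimpleGraph.connectedComponentMk).tsum_eq]
  refine (tsum_congr fun c => ?_).trans tsum_zero
  obtain ⟨o, ho⟩ := c.nonempty_supp
  have he := isNullSequence_normalizedGreen (G.component_preconnected c)
    ((hrec c).green_self_eq_top ⟨o, ho⟩)
  have hcomp := he.tsum_divergence_eq_zero (φ := fun x z : c.supp => φ x z) (fun x z => hanti x z)
    (ne_top_of_le_ne_top hφ (G.energy_component_le c φ))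
    (by simp only [divergence_component]; exact hdiv.subtype c.supp)
  simp only [divergence_component] at hcomp
  exact hcomp

variable {c}

theorem energy_grad_extend (u : c.supp → E) :
    G.energy (grad (Function.extend Subtype.val u 0)) = (G.component c).energy (grad u) := by
  have hinj : Function.Injective (Prod.map (Subtype.val : c.supp → V) (Subtype.val : c.supp → V)) :=
    Subtype.val_injective.prodMap Subtype.val_injective
  rw [energy, weightedSqNorm, ← hinj.tsum_eq]
  · simp only [Prod.map_fst, Prod.map_snd, grad, Subtype.val_injective.extend_apply]
    rfl
  · rintro ⟨x, z⟩ hp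
    by_contra hrange
    refine hp ?_
    by_cases hx : x ∈ c.supp <;> by_cases hz : z ∈ c.supp
    · exact absurd ⟨(⟨x, hx⟩, ⟨z, hz⟩), rfl⟩ hrange
    · simp [b_eq_zero_of_notMem_supp hx hz]
    · simp [G.symm x z, b_eq_zero_of_notMem_supp hz hx]
    · simp [grad, extend_val_of_notMem, hx, hz]

theorem divergence_grad_extend [NormedSpace ℝ E] (u : c.supp → E) :
    G.divergence (grad (Function.extend Subtype.val u 0)) =
      Function.extend Subtype.val ((G.component c).divergence (grad u)) 0 := by
  ext x
  by_cases hx : x ∈ c.supp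
  · lift x to c.supp using hx
    rw [Subtype.val_injective.extend_apply, ← divergence_component]
    simp only [grad, Subtype.val_injective.extend_apply]
    rfl
  · rw [extend_val_of_notMem _ hx, divergence]
    refine (tsum_congr fun z => ?_).trans tsum_zero
    by_cases hz : z ∈ c.supp
    · rw [G.symm, b_eq_zero_of_notMem_supp hz hx, zero_smul]
    · simp [grad, extend_val_of_notMem, hx, hz]

variable {G} in
theorem IsMonopole.extend [DecidableEq V] {μ : V → ℝ} {v₀ : c.supp} {u : c.supp → ℂ}
    (hu : (G.component c).IsMonopole (fun x => μ x) v₀ u) :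
    G.IsMonopole μ v₀ (Function.extend Subtype.val u 0) := by
  obtain ⟨hfin, hlap⟩ := hu
  rw [mem_finiteEnergy_iff] at hfin
  refine ⟨(G.mem_finiteEnergy_iff _).2 (by rwa [energy_grad_extend]), ?_⟩
  ext x
  rw [laplacian_eq, divergence_grad_extend]
  by_cases hx : x ∈ c.supp
  · lift x to c.supp using hx
    rw [Subtype.val_injective.extend_apply, ← laplacian_eq _ (fun x : c.supp => μ x), hlap]
    simp only [Pi.single_apply, Subtype.ext_iff]
  · have hne : x ≠ v₀ := fun h => hx (h ▸ v₀.2)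
    rw [extend_val_of_notMem _ hx, Pi.single_eq_of_ne hne, mul_zero]

end Component

/-! ### Monopoles on transient graphs -/

theorem hasSum_smul_grad_green {o : V} (hfin : ∀ x, G.green o x ≠ ⊤) (x : V) :
    HasSum (fun z => G.b x z • grad (fun y => (G.green o y).toReal) x z)
      (({o} : Set V).indicator G.deg x) := by
  have hsum : ENNReal.ofReal (G.deg x) * G.transition (G.green o) x =
      ∑' z, ENNReal.ofReal (G.b x z) * G.green o z := G.ofReal_deg_mul_transition _ x
  have hle := G.transition_green_le o x
  have hne : G.transition (G.green o) x ≠ ⊤ := ne_top_of_le_ne_top (hfin x) hle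
  have hne' : ∑' z, ENNReal.ofReal (G.b x z) * G.green o z ≠ ⊤ := hsum ▸ by finiteness
  have hgreen : HasSum (fun z => G.b x z * (G.green o z).toReal)
      (G.deg x * (G.transition (G.green o) x).toReal) := by
    rw [← ENNReal.toReal_ofReal (G.deg_nonneg x), ← ENNReal.toReal_mul, hsum,
      ENNReal.tsum_toReal_eq (ENNReal.ne_top_of_tsum_ne_top hne')]
    simpa only [ENNReal.toReal_mul, ENNReal.toReal_ofReal (G.nonneg x _)] using
      ENNReal.hasSum_toReal hne'
  have hx : (G.green o x).toReal =
      ({o} : Set V).indicator 1 x + (G.transition (G.green o) x).toReal := by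
    conv_lhs => rw [green_eq, Pi.add_apply, ENNReal.toReal_add (by by_cases x = o <;> simp [*]) hne]
    congr 1
    by_cases h : x = o <;> simp [h]
  have hind : ({o} : Set V).indicator G.deg x =
      G.deg x * (G.green o x).toReal - G.deg x * (G.transition (G.green o) x).toReal := by
    rw [hx, mul_add, add_sub_cancel_right]
    by_cases h : x = o <;> simp [h]
  have hdeg : HasSum (fun z => G.b x z * (G.green o x).toReal) (G.deg x * (G.green o x).toReal) :=
    (G.summable x).hasSum.mul_right _
  simpa only [hind, grad, smul_eq_mul, mul_sub] using hdeg.sub hgreen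

theorem exists_isMonopole_of_preconnected [DecidableEq V] (hG : G.toSimpleGraph.Preconnected)
    (h : ¬ G.Recurrent) {μ : V → ℝ} (hμ : ∀ x, μ x ≠ 0) : ∃ v₀ u, G.IsMonopole μ v₀ u := by
  obtain ⟨o, ho⟩ := G.exists_green_self_ne_top hG h
  have hfin := G.green_ne_top hG ho
  let f : ℝ →L[ℝ] ℂ := (μ o / G.deg o) • Complex.ofRealCLM
  refine ⟨o, f ∘ fun x => (G.green o x).toReal, ?_, ?_⟩
  · rw [mem_finiteEnergy_iff]
    refine ne_top_of_le_ne_top ?_ (G.energy_grad_comp_le f.lipschitz _)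
    have := G.energy_grad_green_ne_top hfin
    finiteness
  · ext x
    have hdiv : HasSum (fun z => G.b x z • grad (f ∘ fun x => (G.green o x).toReal) x z)
        (f (({o} : Set V).indicator G.deg x)) := by
      simpa only [grad, map_smul, map_sub, Function.comp_apply] using
        f.hasSum (G.hasSum_smul_grad_green hfin x)
    rw [laplacian_eq, divergence, hdiv.tsum_eq]
    by_cases hx : x = o
    · subst hx
      have hdeg := G.deg_pos_of_green_self_ne_top ho
      simp [f, hdeg.ne', hμ]
    · simp [hx]

theorem exists_isMonopole [DecidableEq V] {μ : V → ℝ} (hμ : ∀ x, μ x ≠ 0)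
    (c : G.toSimpleGraph.ConnectedComponent) (hc : ¬ (G.component c).Recurrent) :
    ∃ v₀ ∈ c.supp, ∃ u, G.IsMonopole μ v₀ u := by
  obtain ⟨v₀, u, hu⟩ := (G.component c).exists_isMonopole_of_preconnected
    (G.component_preconnected c) hc (μ := fun x => μ x) fun x => hμ x
  exact ⟨v₀, v₀.2, _, hu.extend⟩

/-! ### Functions on oriented edges -/

section Dart

variable {E : Type*} [NormedAddCommGroup E]

/-- A function on the oriented edges of the graph, extended by zero to all pairs of vertices. -/
def extendDarts (F : G.toSimpleGraph.Dart → E) (x y : V) : E :=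
  Function.extend SimpleGraph.Dart.toProd F 0 (x, y)

theorem extendDarts_apply (F : G.toSimpleGraph.Dart → E) (e : G.toSimpleGraph.Dart) :
    G.extendDarts F e.fst e.snd = F e :=
  SimpleGraph.Dart.toProd_injective.extend_apply F 0 e

theorem extendDarts_of_not_adj (F : G.toSimpleGraph.Dart → E) {x y : V}
    (h : ¬G.toSimpleGraph.Adj x y) : G.extendDarts F x y = 0 :=
  Function.extend_apply' _ _ _ fun ⟨e, he⟩ => h (by simpa only [he] using e.adj)

theorem extendDarts_antisymm {F : G.toSimpleGraph.Dart → E} (hF : ∀ e, F e.symm = -F e) (x y : V) :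
    G.extendDarts F y x = -G.extendDarts F x y := by
  by_cases h : G.toSimpleGraph.Adj x y
  · have hsymm := G.extendDarts_apply F (SimpleGraph.Dart.symm ⟨(x, y), h⟩)
    rwa [hF, ← G.extendDarts_apply F ⟨(x, y), h⟩] at hsymm
  · rw [G.extendDarts_of_not_adj F h, G.extendDarts_of_not_adj F (mt (·.symm) h), neg_zero]

theorem b_eq_zero_of_not_adj {x y : V} (h : ¬G.toSimpleGraph.Adj x y) : G.b x y = 0 :=
  (not_lt.1 h).antisymm (G.nonneg x y)

theorem energy_eq_weightedSqNorm_dart (φ : V → V → E) : G.energy φ =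
    weightedSqNorm (fun e : G.toSimpleGraph.Dart => G.b e.fst e.snd) fun e => φ e.fst e.snd := by
  refine (SimpleGraph.Dart.toProd_injective.tsum_eq
    (f := fun p : V × V => ENNReal.ofReal (G.b p.1 p.2) * ‖φ p.1 p.2‖ₑ ^ 2) fun p hp => ?_).symm
  by_contra h
  have hadj : ¬G.toSimpleGraph.Adj p.1 p.2 := fun hadj => h ⟨⟨p, hadj⟩, rfl⟩
  exact hp (by simp only [b_eq_zero_of_not_adj G hadj, ENNReal.ofReal_zero, zero_mul])

end Dart

end WGraph

/-! ### Simplices around a given simplex -/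

theorem IsFace.exists_insert {X : Type*} [DecidableEq X] {τ σ : Finset X} (h : IsFace τ σ) :
    ∃ v, v ∉ τ ∧ insert v τ = σ := by
  simpa only [exists_prop] using Finset.exists_eq_insert_iff.2 ⟨h.1, h.2.symm⟩

theorem isFace_insert {X : Type*} [DecidableEq X] {τ : Finset X} {v : X} (h : v ∉ τ) :
    IsFace τ (insert v τ) :=
  ⟨Finset.subset_insert _ _, Finset.card_insert_of_notMem h⟩

theorem isFace_erase {X : Type*} [DecidableEq X] {σ : Finset X} {v : X} (h : v ∈ σ) :
    IsFace (σ.erase v) σ :=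
  ⟨Finset.erase_subset _ _, (Finset.card_erase_add_one h).symm⟩

namespace WeightedComplex

variable {X : Type*} (K : WeightedComplex X)

theorem mem_simplices_of_subset {σ τ : Finset X} (hσ : σ ∈ K.simplices) (h : τ ⊆ σ)
    (hτ : τ.Nonempty) : τ ∈ K.simplices :=
  ⟨K.down_closed σ hσ.1 τ h, fun h0 => absurd h0 hτ.ne_empty⟩

theorem weight_pos (σ : K.Simplex) : 0 < K.m σ.1 := K.m_pos _ σ.2.1

theorem isL2_iff (ω : K.Simplex → ℂ) :
    K.IsL2 ω ↔ weightedSqNorm (fun σ : K.Simplex => K.m σ.1) ω ≠ ⊤ :=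
  summable_mul_norm_sq_iff (fun σ => (K.weight_pos σ).le) ω

variable {K} in
theorem IsL2.mem_boundaryDomain {ω : K.Simplex → ℂ} (h : K.IsL2 ω) : ω ∈ K.boundaryDomain := by
  intro ρ
  have hcoface : Summable fun τ : {τ : K.Simplex // IsFace ρ.1 τ.1} => K.m τ.1.1 * ‖ω τ.1‖ ^ 2 :=
    h.comp_injective Subtype.val_injective
  refine Summable.of_nonneg_of_le (fun τ => mul_nonneg (K.weight_pos _).le (norm_nonneg _))
    (fun τ => ?_) ((K.locallySummable ρ).add hcoface)
  rw [← mul_one_add]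
  exact mul_le_mul_of_nonneg_left (by nlinarith only [sq_nonneg (‖ω τ.1‖ - 1)])
    (K.weight_pos τ.1).le

variable [DecidableEq X] {K} {ρ : K.Simplex}

/-- The simplex `vρ`. -/
def join (v : K.link ρ) : K.Simplex := ⟨insert v.1 ρ.1, v.2.2.1⟩

theorem isFace_join (v : K.link ρ) : IsFace ρ.1 (join v).1 := v.2.2.2

theorem linkWeight_pos (v : K.link ρ) : 0 < K.linkWeight ρ v := K.weight_pos (join v)

theorem mem_link_of_insert_subset {σ : K.Simplex} {v : X} (hv : v ∉ ρ.1) (h : insert v ρ.1 ⊆ σ.1) :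
    v ∈ K.link ρ :=
  ⟨K.mem_simplices_of_subset σ.2 (Finset.singleton_subset_iff.2 (h (Finset.mem_insert_self _ _)))
      (Finset.singleton_nonempty _),
    K.mem_simplices_of_subset σ.2 h (Finset.insert_nonempty _ _), isFace_insert hv⟩

theorem join_injective : Function.Injective (join : K.link ρ → K.Simplex) := fun v _ h =>
  Subtype.ext ((Finset.insert_inj (K.notMem_of_link v)).1 (congrArg Subtype.val h))

theorem exists_join_eq {τ : K.Simplex} (h : IsFace ρ.1 τ.1) : ∃ v : K.link ρ, join v = τ := by
  obtain ⟨v, hv, e⟩ := h.exists_insert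
  exact ⟨⟨v, mem_link_of_insert_subset (σ := τ) hv e.subset⟩, Subtype.ext e⟩

variable (ρ) in
/-- The bijection `v ↦ vρ` between the link and the cofaces of `ρ`. -/
def linkEquiv : K.link ρ ≃ {τ : K.Simplex // IsFace ρ.1 τ.1} :=
  Equiv.ofBijective (fun v => ⟨join v, isFace_join v⟩)
    ⟨fun _ _ h => join_injective (congrArg Subtype.val h), fun τ =>
      (exists_join_eq τ.2).imp fun _ hv => Subtype.ext hv⟩

theorem coe_linkEquiv_apply (v : K.link ρ) : (linkEquiv ρ v).1 = join v := rfl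

/-! ### Edges of the link -/

variable (ρ) in
/-- The oriented edges of the graph on the link of `ρ`. -/
abbrev LinkDart : Type _ := (K.linkGraph ρ).toSimpleGraph.Dart

theorem linkGraph_b_of_mem {v w : K.link ρ}
    (h : v ≠ w ∧ insert v.1 (insert w.1 ρ.1) ∈ K.simplices) :
    (K.linkGraph ρ).b v w = K.m (insert v.1 (insert w.1 ρ.1)) :=
  if_pos h

theorem linkGraph_adj_iff {v w : K.link ρ} : (K.linkGraph ρ).toSimpleGraph.Adj v w ↔
    v ≠ w ∧ insert v.1 (insert w.1 ρ.1) ∈ K.simplices := by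
  refine ⟨fun h => by_contra fun h0 => LT.lt.ne' h (if_neg h0), fun h => ?_⟩
  exact (K.m_pos _ h.2.1).trans_eq (linkGraph_b_of_mem h).symm

/-- The simplex `vv'ρ` given by an oriented edge `(v, v')` of the link. -/
def edgeSimplex (e : LinkDart ρ) : K.Simplex :=
  ⟨insert e.fst.1 (insert e.snd.1 ρ.1), (linkGraph_adj_iff.1 e.adj).2⟩

theorem linkGraph_b_eq (e : LinkDart ρ) : (K.linkGraph ρ).b e.fst e.snd = K.m (edgeSimplex e).1 :=
  linkGraph_b_of_mem (linkGraph_adj_iff.1 e.adj)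

theorem edgeSimplex_symm (e : LinkDart ρ) : edgeSimplex e.symm = edgeSimplex e :=
  Subtype.ext (Finset.insert_comm _ _ _)

theorem isFace_join_snd (e : LinkDart ρ) : IsFace (join e.snd).1 (edgeSimplex e).1 :=
  isFace_insert fun h => (Finset.mem_insert.1 h).elim
    (fun h => (linkGraph_adj_iff.1 e.adj).1 (Subtype.ext h)) (K.notMem_of_link e.fst)

theorem isFace_join_fst (e : LinkDart ρ) : IsFace (join e.fst).1 (edgeSimplex e).1 := by
  rw [← edgeSimplex_symm]
  exact isFace_join_snd e.symm

theorem subset_edgeSimplex (e : LinkDart ρ) : ρ.1 ⊆ (edgeSimplex e).1 :=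
  (isFace_join _).1.trans (isFace_join_fst e).1

theorem card_edgeSimplex (e : LinkDart ρ) : (edgeSimplex e).1.card = ρ.1.card + 2 := by
  rw [(isFace_join_fst e).2, (isFace_join _).2]

theorem eq_fst_or_eq_snd_of_isFace {e : LinkDart ρ} {v : K.link ρ}
    (h : IsFace (join v).1 (edgeSimplex e).1) : v = e.fst ∨ v = e.snd := by
  have hv : v.1 ∈ insert e.fst.1 (insert e.snd.1 ρ.1) := h.1 (Finset.mem_insert_self _ _)
  simpa only [Finset.mem_insert, Subtype.coe_inj, K.notMem_of_link v, or_false] using hv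

theorem eq_or_eq_symm_of_edgeSimplex_eq {e e' : LinkDart ρ} (h : edgeSimplex e' = edgeSimplex e) :
    e' = e ∨ e' = e.symm := by
  have hne := e'.fst_ne_snd
  rcases eq_fst_or_eq_snd_of_isFace (h ▸ isFace_join_fst e') with hfst | hfst <;>
    rcases eq_fst_or_eq_snd_of_isFace (h ▸ isFace_join_snd e') with hsnd | hsnd
  · exact absurd (hfst.trans hsnd.symm) hne
  · exact .inl (SimpleGraph.Dart.ext _ _ (Prod.ext hfst hsnd))
  · exact .inr (SimpleGraph.Dart.ext _ _ (Prod.ext hfst hsnd))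
  · exact absurd (hfst.trans hsnd.symm) hne

theorem exists_dart_of_isFace {v : K.link ρ} {σ : K.Simplex} (h : IsFace (join v).1 σ.1) :
    ∃ e : LinkDart ρ, edgeSimplex e = σ ∧ e.fst = v := by
  obtain ⟨w, hw, e⟩ := h.exists_insert
  obtain ⟨hwv, hwρ⟩ : w ≠ v.1 ∧ w ∉ ρ.1 := by simpa only [join, Finset.mem_insert, not_or] using hw
  have hwl : w ∈ K.link ρ := mem_link_of_insert_subset (σ := σ) hwρ
    (e ▸ Finset.insert_subset_insert _ (Finset.subset_insert _ _))
  have hσ : insert v.1 (insert w ρ.1) = σ.1 := (Finset.insert_comm _ _ _).trans e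
  exact ⟨⟨(v, ⟨w, hwl⟩), linkGraph_adj_iff.2
    ⟨fun h => hwv (congrArg Subtype.val h).symm, hσ ▸ σ.2⟩⟩, Subtype.ext hσ, rfl⟩

theorem finsum_face_edgeSimplex {F : K.Simplex → ℂ} (hF : ∀ τ, ¬IsFace ρ.1 τ.1 → F τ = 0)
    (e : LinkDart ρ) : ∑ᶠ τ : {τ : K.Simplex // IsFace τ.1 (edgeSimplex e).1}, F τ =
      F (join e.fst) + F (join e.snd) := by
  classical
  set fst : {τ : K.Simplex // IsFace τ.1 (edgeSimplex e).1} := ⟨join e.fst, isFace_join_fst e⟩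
  set snd : {τ : K.Simplex // IsFace τ.1 (edgeSimplex e).1} := ⟨join e.snd, isFace_join_snd e⟩
  have hne : fst ≠ snd := fun h => e.fst_ne_snd (join_injective (congrArg Subtype.val h))
  rw [finsum_eq_finsetSum_of_support_subset (s := {fst, snd}), Finset.sum_pair hne]
  intro τ hτ
  obtain ⟨v, hv⟩ := exists_join_eq (not_imp_comm.1 (hF τ) hτ)
  rw [Finset.coe_insert, Finset.coe_singleton]
  refine (eq_fst_or_eq_snd_of_isFace (hv ▸ τ.2)).imp ?_ ?_ <;> rintro rfl <;>
    exact Subtype.ext hv.symm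

theorem divergence_eq_tsum_coface {v : K.link ρ} {φ : K.link ρ → K.link ρ → ℂ} {F : K.Simplex → ℂ}
    (hφ : ∀ e : LinkDart ρ, e.fst = v → φ e.fst e.snd = F (edgeSimplex e)) :
    (K.linkGraph ρ).divergence φ v =
      ∑' σ : {σ : K.Simplex // IsFace (join v).1 σ.1}, K.m σ.1.1 • F σ := by
  have hbij : Function.Bijective (K.linkCoface ρ v) := by
    refine ⟨K.linkCoface_injective ρ v, fun σ => ?_⟩
    obtain ⟨e, he, rfl⟩ := exists_dart_of_isFace σ.2
    exact ⟨⟨e.snd, linkGraph_adj_iff.1 e.adj⟩, Subtype.ext he⟩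
  have hsupp : (Function.support fun w => (K.linkGraph ρ).b v w • φ v w) ⊆
      {w | v ≠ w ∧ insert v.1 (insert w.1 ρ.1) ∈ K.simplices} := by
    intro w hw
    by_contra h
    exact hw (by
      simp only [WGraph.b_eq_zero_of_not_adj _ (mt linkGraph_adj_iff.1 h), zero_smul])
  rw [WGraph.divergence, ← tsum_subtype_eq_of_support_subset hsupp]
  refine Eq.trans (tsum_congr fun w => ?_) ((Equiv.ofBijective _ hbij).tsum_eq
    fun σ : {σ : K.Simplex // IsFace (join v).1 σ.1} => K.m σ.1.1 • F σ)
  exact congrArg₂ (· • ·) (linkGraph_b_of_mem w.2) (hφ ⟨(v, w.1), linkGraph_adj_iff.2 w.2⟩ rfl)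

theorem encard_edgeSimplex_fiber_le (σ : K.Simplex) :
    ((edgeSimplex : LinkDart ρ → K.Simplex) ⁻¹' {σ}).encard ≤ 2 := by
  rcases ((edgeSimplex : LinkDart ρ → K.Simplex) ⁻¹' {σ}).eq_empty_or_nonempty with h | ⟨e, he⟩
  · simp only [h, Set.encard_empty, zero_le]
  · have hsub : (edgeSimplex : LinkDart ρ → K.Simplex) ⁻¹' {σ} ⊆ {e, e.symm} := fun e' he' =>
      eq_or_eq_symm_of_edgeSimplex_eq (Eq.trans he' (Eq.symm he))
    exact (Set.encard_le_encard hsub).trans (Set.encard_pair e.symm_ne.symm).le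

namespace Coboundary

variable (d : K.Coboundary)

/-! ### Incidence numbers -/

theorem θ_eq_zero {τ σ : K.Simplex} (h : ¬IsFace τ.1 σ.1) : d.θ τ σ = 0 :=
  not_not.1 (mt (d.entry_ne_zero_iff τ σ).1 h)

theorem θ_mul_self {τ σ : K.Simplex} (h : IsFace τ.1 σ.1) : d.θ τ σ * d.θ τ σ = 1 := by
  have hne : d.θ τ σ ≠ 0 := (d.entry_ne_zero_iff τ σ).2 h
  obtain h1 | h1 | h0 : d.θ τ σ = 1 ∨ d.θ τ σ = -1 ∨ d.θ τ σ = 0 := d.entry τ σ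
  · rw [h1, one_mul]
  · rw [h1, neg_one_mul, neg_neg]
  · exact absurd h0 hne

theorem norm_θ {τ σ : K.Simplex} (h : IsFace τ.1 σ.1) : ‖d.θ τ σ‖ = 1 :=
  Complex.norm_eq_one_of_pow_eq_one ((sq _).trans (d.θ_mul_self h)) two_ne_zero

/-- The product `θ(ρ, vρ) θ(vρ, vv'ρ)` for an oriented edge `(v, v')` of the link of `ρ`. It relates
the cochains on `Σ` to the functions on the oriented edges of the link. -/
def sign (e : LinkDart ρ) : ℂ := d.θ ρ (join e.fst) * d.θ (join e.fst) (edgeSimplex e)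

theorem sign_mul_self (e : LinkDart ρ) : d.sign e * d.sign e = 1 := by
  rw [sign, mul_mul_mul_comm, d.θ_mul_self (isFace_join _), d.θ_mul_self (isFace_join_fst e),
    one_mul]

theorem norm_sign (e : LinkDart ρ) : ‖d.sign e‖ = 1 :=
  Complex.norm_eq_one_of_pow_eq_one ((sq _).trans (d.sign_mul_self e)) two_ne_zero

theorem sign_symm_eq (e : LinkDart ρ) :
    d.sign e.symm = d.θ ρ (join e.snd) * d.θ (join e.snd) (edgeSimplex e) := by
  rw [← edgeSimplex_symm]
  rfl

theorem δ_edgeSimplex {ω : K.Simplex → ℂ} (hω : ∀ τ, ¬IsFace ρ.1 τ.1 → ω τ = 0) (e : LinkDart ρ) :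
    d.δ ω (edgeSimplex e) = d.θ (join e.fst) (edgeSimplex e) * ω (join e.fst) +
      d.θ (join e.snd) (edgeSimplex e) * ω (join e.snd) := by
  rw [d.apply_eq]
  exact finsum_face_edgeSimplex (F := fun τ => d.θ τ (edgeSimplex e) * ω τ)
    (fun τ h => by rw [hω τ h, mul_zero]) e

theorem sign_symm (e : LinkDart ρ) : d.sign e.symm = -d.sign e := by
  have hδδ : d.δ (d.δ (Pi.single ρ 1)) (edgeSimplex e) = 0 := congrFun (d.comp_self _) _
  rw [d.δ_edgeSimplex (ω := d.δ (Pi.single ρ 1)) fun τ h => d.θ_eq_zero h] at hδδ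
  change _ * d.θ ρ _ + _ * d.θ ρ _ = 0 at hδδ
  rw [sign_symm_eq, sign]
  linear_combination hδδ

/-! ### The flow given by a cochain -/

theorem boundary_eq_tsum_link (ω : K.Simplex → ℂ) (ρ : K.Simplex) : d.boundary ω ρ =
    (1 / (K.m ρ.1 : ℂ)) * ∑' v, (K.linkWeight ρ v : ℂ) * d.θ ρ (join v) * ω (join v) := by
  rw [boundary, ← (linkEquiv ρ).tsum_eq]
  rfl

/-- The function on the oriented edges of the link of `ρ` given by the values of the cochain `ω` on
the simplices `vv'ρ`. -/
def flow (ρ : K.Simplex) (ω : K.Simplex → ℂ) : K.link ρ → K.link ρ → ℂ :=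
  (K.linkGraph ρ).extendDarts fun e => d.sign e * ω (edgeSimplex e)

theorem flow_dart (ω : K.Simplex → ℂ) (e : LinkDart ρ) :
    d.flow ρ ω e.fst e.snd = d.sign e * ω (edgeSimplex e) :=
  WGraph.extendDarts_apply _ _ e

theorem flow_antisymm (ω : K.Simplex → ℂ) (v w : K.link ρ) :
    d.flow ρ ω w v = -d.flow ρ ω v w :=
  WGraph.extendDarts_antisymm _ (fun e => by rw [sign_symm, edgeSimplex_symm, neg_mul]) v w

theorem divergence_flow (ω : K.Simplex → ℂ) (v : K.link ρ) :
    (K.linkGraph ρ).divergence (d.flow ρ ω) v =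
      (K.linkWeight ρ v : ℂ) * d.θ ρ (join v) * d.boundary ω (join v) := by
  have hm : (K.m (join v).1 : ℂ) ≠ 0 := Complex.ofReal_ne_zero.2 (K.weight_pos (join v)).ne'
  have hcoface : (K.linkGraph ρ).divergence (d.flow ρ ω) v =
      ∑' σ : {σ : K.Simplex // IsFace (join v).1 σ.1},
        K.m σ.1.1 • (d.θ ρ (join v) * (d.θ (join v) σ * ω σ)) :=
    divergence_eq_tsum_coface (F := fun σ => d.θ ρ (join v) * (d.θ (join v) σ * ω σ))
      fun e he => by rw [flow_dart, sign, he, mul_assoc]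
  have hterm : ∀ σ : {σ : K.Simplex // IsFace (join v).1 σ.1},
      K.m σ.1.1 • (d.θ ρ (join v) * (d.θ (join v) σ * ω σ)) =
        d.θ ρ (join v) * ((K.m σ.1.1 : ℂ) * d.θ (join v) σ * ω σ) := fun σ => by
    rw [Complex.real_smul]; ring
  rw [hcoface, tsum_congr hterm, tsum_mul_left, boundary, linkWeight]
  change _ = (K.m (join v).1 : ℂ) * _ * _
  field_simp

theorem energy_flow_le (ρ : K.Simplex) (ω : K.Simplex → ℂ) : (K.linkGraph ρ).energy (d.flow ρ ω) ≤
    2 * weightedSqNorm (fun σ : K.Simplex => K.m σ.1) ω := by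
  have hdart : (K.linkGraph ρ).energy (d.flow ρ ω) =
      ∑' e : LinkDart ρ, ENNReal.ofReal (K.m (edgeSimplex e).1) * ‖ω (edgeSimplex e)‖ₑ ^ 2 := by
    rw [WGraph.energy_eq_weightedSqNorm_dart]
    refine tsum_congr fun e => ?_
    beta_reduce
    rw [linkGraph_b_eq, flow_dart, enorm_mul, ← ofReal_norm (d.sign e), norm_sign,
      ENNReal.ofReal_one, one_mul]
  rw [hdart]
  exact tsum_comp_le_mul_tsum (fun σ : K.Simplex => ENNReal.ofReal (K.m σ.1) * ‖ω σ‖ₑ ^ 2)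
    encard_edgeSimplex_fiber_le

theorem boundary_boundary_eq_tsum_divergence (ω : K.Simplex → ℂ) (ρ : K.Simplex) :
    d.boundary (d.boundary ω) ρ =
      (1 / (K.m ρ.1 : ℂ)) * ∑' v, (K.linkGraph ρ).divergence (d.flow ρ ω) v := by
  simp only [boundary_eq_tsum_link _ (d.boundary ω), divergence_flow]

theorem boundary_boundary_eq_zero {ω : K.Simplex → ℂ} (hω : K.IsL2 ω)
    (hω' : d.boundary ω ∈ K.boundaryDomain) (hρ : K.LinkRecurrent ρ) :
    d.boundary (d.boundary ω) ρ = 0 := by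
  have henergy : (K.linkGraph ρ).energy (d.flow ρ ω) ≠ ⊤ := ne_top_of_le_ne_top
    (ENNReal.mul_ne_top ENNReal.ofNat_ne_top ((K.isL2_iff ω).1 hω)) (d.energy_flow_le ρ ω)
  have hdiv : Summable fun v => ‖(K.linkGraph ρ).divergence (d.flow ρ ω) v‖ := by
    refine ((linkEquiv ρ).summable_iff.2 (hω' ρ)).congr fun v => ?_
    rw [divergence_flow, norm_mul, norm_mul, d.norm_θ (isFace_join v), mul_one, Complex.norm_real,
      Real.norm_of_nonneg (linkWeight_pos v).le]
    rfl
  rw [boundary_boundary_eq_tsum_divergence,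
    WGraph.tsum_divergence_eq_zero hρ (d.flow_antisymm ω) henergy hdiv, mul_zero]

/-! ### The cochain `δ π^ρ u` -/

theorem lift_join (u : K.link ρ → ℂ) (v : K.link ρ) :
    d.lift ρ u (join v) = u v * d.θ ρ (join v) := by
  have h : ∃ w : K.link ρ, insert w.1 ρ.1 = (join v).1 := ⟨v, rfl⟩
  have hchoose : h.choose = v := join_injective (Subtype.ext h.choose_spec)
  rw [lift, dif_pos h, hchoose]

theorem lift_of_not_isFace (u : K.link ρ → ℂ) {τ : K.Simplex} (h : ¬IsFace ρ.1 τ.1) :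
    d.lift ρ u τ = 0 :=
  dif_neg fun ⟨v, hv⟩ => h (hv ▸ isFace_join v)

theorem δ_lift_edgeSimplex (u : K.link ρ → ℂ) (e : LinkDart ρ) :
    d.δ (d.lift ρ u) (edgeSimplex e) = d.sign e * WGraph.grad u e.fst e.snd := by
  have hsymm := d.sign_symm e
  rw [sign_symm_eq, sign] at hsymm
  rw [d.δ_edgeSimplex fun τ h => d.lift_of_not_isFace u h, lift_join, lift_join, sign, WGraph.grad]
  linear_combination u e.snd * hsymm

theorem exists_dart_of_δ_lift_ne_zero {u : K.link ρ → ℂ} {σ : K.Simplex}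
    (h : d.δ (d.lift ρ u) σ ≠ 0) : ∃ e : LinkDart ρ, edgeSimplex e = σ := by
  rw [d.apply_eq] at h
  obtain ⟨τ, hτ⟩ : ∃ τ : {τ : K.Simplex // IsFace τ.1 σ.1}, d.θ τ σ * d.lift ρ u τ ≠ 0 := by
    by_contra! h0
    exact h (finsum_eq_zero_of_forall_eq_zero h0)
  have hface : IsFace ρ.1 τ.1.1 := by
    by_contra h0
    exact hτ (by rw [d.lift_of_not_isFace u h0, mul_zero])
  obtain ⟨v, hv⟩ := exists_join_eq hface
  exact (exists_dart_of_isFace (hv ▸ τ.2)).imp fun _ => And.left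

theorem weightedSqNorm_δ_lift_le (u : K.link ρ → ℂ) :
    weightedSqNorm (fun σ : K.Simplex => K.m σ.1) (d.δ (d.lift ρ u)) ≤
      (K.linkGraph ρ).energy (WGraph.grad u) := by
  rw [WGraph.energy_eq_weightedSqNorm_dart]
  refine (tsum_le_tsum_comp_of_support_subset_range (q := (edgeSimplex : LinkDart ρ → K.Simplex))
    fun σ hσ => ?_).trans_eq (tsum_congr fun e => ?_)
  · exact d.exists_dart_of_δ_lift_ne_zero (u := u) fun h => hσ (by simp [h])
  · beta_reduce
    rw [linkGraph_b_eq, δ_lift_edgeSimplex, enorm_mul, ← ofReal_norm (d.sign e), norm_sign,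
      ENNReal.ofReal_one, one_mul]

theorem isL2_δ_lift {u : K.link ρ → ℂ} (hu : u ∈ (K.linkGraph ρ).finiteEnergy) :
    K.IsL2 (d.δ (d.lift ρ u)) :=
  (K.isL2_iff _).2 (ne_top_of_le_ne_top ((WGraph.mem_finiteEnergy_iff _ u).1 hu)
    (d.weightedSqNorm_δ_lift_le u))

theorem divergence_flow_δ_lift (u : K.link ρ → ℂ) (v : K.link ρ) :
    (K.linkGraph ρ).divergence (d.flow ρ (d.δ (d.lift ρ u))) v =
      (K.linkWeight ρ v : ℂ) * (K.linkGraph ρ).laplacian (K.linkWeight ρ) u v := by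
  have hm : (K.linkWeight ρ v : ℂ) ≠ 0 := Complex.ofReal_ne_zero.2 (linkWeight_pos v).ne'
  rw [WGraph.laplacian_eq, ← mul_assoc, mul_one_div_cancel hm, one_mul]
  refine tsum_congr fun w => ?_
  by_cases h : (K.linkGraph ρ).toSimpleGraph.Adj v w
  · let e : LinkDart ρ := ⟨(v, w), h⟩
    have hflow := d.flow_dart (d.δ (d.lift ρ u)) e
    rw [δ_lift_edgeSimplex, ← mul_assoc, sign_mul_self, one_mul] at hflow
    exact congrArg _ hflow
  · rw [WGraph.b_eq_zero_of_not_adj _ h, zero_smul, zero_smul]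

theorem boundary_boundary_δ_lift_ne_zero {u : K.link ρ → ℂ} {v₀ : K.link ρ}
    (hu : (K.linkGraph ρ).IsMonopole (K.linkWeight ρ) v₀ u) :
    d.boundary (d.boundary (d.δ (d.lift ρ u))) ρ ≠ 0 := by
  have hdiv : ∀ v ≠ v₀, (K.linkGraph ρ).divergence (d.flow ρ (d.δ (d.lift ρ u))) v = 0 :=
    fun v hv => by rw [divergence_flow_δ_lift, hu.2, Pi.single_eq_of_ne hv, mul_zero]
  rw [boundary_boundary_eq_tsum_divergence, tsum_eq_single v₀ hdiv, divergence_flow_δ_lift, hu.2,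
    Pi.single_eq_same, mul_one]
  exact mul_ne_zero (one_div_ne_zero (Complex.ofReal_ne_zero.2 (K.weight_pos ρ).ne'))
    (Complex.ofReal_ne_zero.2 (linkWeight_pos v₀).ne')

/-! ### Square summability of `∂ δ π^ρ u` -/

theorem boundary_δ_lift_join (u : K.link ρ → ℂ) (v : K.link ρ) :
    d.boundary (d.δ (d.lift ρ u)) (join v) =
      d.θ ρ (join v) * (K.linkGraph ρ).laplacian (K.linkWeight ρ) u v := by
  have hm : (K.linkWeight ρ v : ℂ) ≠ 0 := Complex.ofReal_ne_zero.2 (linkWeight_pos v).ne'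
  have hdiv := d.divergence_flow (d.δ (d.lift ρ u)) v
  rw [divergence_flow_δ_lift, mul_assoc] at hdiv
  rw [mul_left_cancel₀ hm hdiv, ← mul_assoc, d.θ_mul_self (isFace_join v), one_mul]

/-- The simplex `vv'ρ \ w` for an oriented edge `(v, v')` of the link of `ρ` and `w ∈ ρ`. These are
the faces of `vv'ρ` which do not contain `ρ`. -/
def eraseSimplex (e : LinkDart ρ) (w : ρ.1) : K.Simplex :=
  ⟨(edgeSimplex e).1.erase w, K.mem_simplices_of_subset (edgeSimplex e).2 (Finset.erase_subset _ _)
    ⟨e.fst.1, Finset.mem_erase.2 ⟨fun h => K.notMem_of_link e.fst (h ▸ w.2),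
      Finset.mem_insert_self _ _⟩⟩⟩

theorem isFace_eraseSimplex (e : LinkDart ρ) (w : ρ.1) :
    IsFace (eraseSimplex e w).1 (edgeSimplex e).1 :=
  isFace_erase (subset_edgeSimplex e w.2)

theorem edgeSimplex_eq_of_isFace_eraseSimplex {e e' : LinkDart ρ} {w : ρ.1}
    (h : IsFace (eraseSimplex e w).1 (edgeSimplex e').1) : edgeSimplex e' = edgeSimplex e := by
  have hsub : (edgeSimplex e).1 ⊆ (edgeSimplex e').1 := by
    rw [← Finset.insert_erase (subset_edgeSimplex e w.2)]
    exact Finset.insert_subset (subset_edgeSimplex e' w.2) h.1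
  refine Subtype.ext (Finset.eq_of_subset_of_card_le hsub ?_).symm
  rw [card_edgeSimplex, card_edgeSimplex]

theorem exists_eraseSimplex_eq {τ : K.Simplex} (hτ : ¬IsFace ρ.1 τ.1) {e : LinkDart ρ}
    (h : IsFace τ.1 (edgeSimplex e).1) : ∃ w : ρ.1, eraseSimplex e w = τ := by
  obtain ⟨w, hw, hins⟩ := h.exists_insert
  have hwρ : w ∈ ρ.1 := by
    by_contra hwρ
    refine hτ ⟨(Finset.subset_insert_iff_of_notMem hwρ).1 (hins ▸ subset_edgeSimplex e), ?_⟩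
    have := h.2
    rw [card_edgeSimplex] at this
    lia
  refine ⟨⟨w, hwρ⟩, Subtype.ext ?_⟩
  change (edgeSimplex e).1.erase w = τ.1
  rw [← hins, Finset.erase_insert hw]

theorem exists_eraseSimplex_of_boundary_δ_lift_ne_zero {u : K.link ρ → ℂ} {τ : K.Simplex}
    (hτ : ¬IsFace ρ.1 τ.1) (h : d.boundary (d.δ (d.lift ρ u)) τ ≠ 0) :
    ∃ e : LinkDart ρ, ∃ w, eraseSimplex e w = τ := by
  obtain ⟨σ, hσ⟩ : ∃ σ : {σ : K.Simplex // IsFace τ.1 σ.1}, d.δ (d.lift ρ u) σ ≠ 0 := by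
    by_contra! h0
    exact h (by simp only [boundary, h0, mul_zero, tsum_zero])
  obtain ⟨e, he⟩ := d.exists_dart_of_δ_lift_ne_zero hσ
  exact ⟨e, exists_eraseSimplex_eq hτ (he ▸ σ.2)⟩

theorem boundary_δ_lift_eraseSimplex (u : K.link ρ → ℂ) (e : LinkDart ρ) (w : ρ.1) :
    d.boundary (d.δ (d.lift ρ u)) (eraseSimplex e w) = (1 / (K.m (eraseSimplex e w).1 : ℂ)) *
      (K.m (edgeSimplex e).1 * d.θ (eraseSimplex e w) (edgeSimplex e) *
        (d.sign e * WGraph.grad u e.fst e.snd)) := by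
  rw [boundary, tsum_eq_single ⟨edgeSimplex e, isFace_eraseSimplex e w⟩, δ_lift_edgeSimplex]
  intro σ hσ
  by_contra h
  obtain ⟨e', he'⟩ := d.exists_dart_of_δ_lift_ne_zero (right_ne_zero_of_mul h)
  exact hσ (Subtype.ext (he'.symm.trans (edgeSimplex_eq_of_isFace_eraseSimplex (he' ▸ σ.2))))

theorem weight_mul_enorm_sq_boundary_δ_lift_eraseSimplex (u : K.link ρ → ℂ) (e : LinkDart ρ)
    (w : ρ.1) : ENNReal.ofReal (K.m (eraseSimplex e w).1) *
        ‖d.boundary (d.δ (d.lift ρ u)) (eraseSimplex e w)‖ₑ ^ 2 =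
      ENNReal.ofReal (K.m (edgeSimplex e).1 / K.m (eraseSimplex e w).1) *
        (ENNReal.ofReal (K.m (edgeSimplex e).1) * ‖WGraph.grad u e.fst e.snd‖ₑ ^ 2) := by
  have hσ := K.weight_pos (edgeSimplex e)
  have hτ := K.weight_pos (eraseSimplex e w)
  have hnorm : ‖d.boundary (d.δ (d.lift ρ u)) (eraseSimplex e w)‖ =
      1 / K.m (eraseSimplex e w).1 * (K.m (edgeSimplex e).1 * ‖WGraph.grad u e.fst e.snd‖) := by
    rw [boundary_δ_lift_eraseSimplex, norm_mul, norm_mul, norm_mul, norm_mul, norm_sign,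
      d.norm_θ (isFace_eraseSimplex e w), norm_div, norm_one, Complex.norm_real, Complex.norm_real,
      Real.norm_of_nonneg hσ.le, Real.norm_of_nonneg hτ.le, mul_one, one_mul]
  rw [← ofReal_mul_norm_sq hτ.le, ← ofReal_mul_norm_sq hσ.le,
    ← ENNReal.ofReal_mul (div_nonneg hσ.le hτ.le), hnorm]
  congr 1
  field_simp

theorem tsum_isFace_boundary_δ_lift (u : K.link ρ → ℂ) :
    ∑' τ : {τ : K.Simplex // IsFace ρ.1 τ.1},
        ENNReal.ofReal (K.m τ.1.1) * ‖d.boundary (d.δ (d.lift ρ u)) τ‖ₑ ^ 2 =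
      weightedSqNorm (K.linkWeight ρ) ((K.linkGraph ρ).laplacian (K.linkWeight ρ) u) := by
  rw [← (linkEquiv ρ).tsum_eq]
  refine tsum_congr fun v => ?_
  rw [coe_linkEquiv_apply, boundary_δ_lift_join, enorm_mul, ← ofReal_norm (d.θ ρ _),
    d.norm_θ (isFace_join v), ENNReal.ofReal_one, one_mul]
  rfl

theorem tsum_boundary_δ_lift_eraseSimplex_le (u : K.link ρ → ℂ) {C : ℝ}
    (hC : ∀ (e : LinkDart ρ) w, K.m (edgeSimplex e).1 / K.m (eraseSimplex e w).1 ≤ C) :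
    ∑' x : LinkDart ρ × ρ.1, ENNReal.ofReal (K.m (eraseSimplex x.1 x.2).1) *
        ‖d.boundary (d.δ (d.lift ρ u)) (eraseSimplex x.1 x.2)‖ₑ ^ 2 ≤
      ρ.1.card * (ENNReal.ofReal C * (K.linkGraph ρ).energy (WGraph.grad u)) := by
  let g (e : LinkDart ρ) :=
    ENNReal.ofReal ((K.linkGraph ρ).b e.fst e.snd) * ‖WGraph.grad u e.fst e.snd‖ₑ ^ 2
  have hg (x : LinkDart ρ × ρ.1) : ENNReal.ofReal (K.m (eraseSimplex x.1 x.2).1) *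
      ‖d.boundary (d.δ (d.lift ρ u)) (eraseSimplex x.1 x.2)‖ₑ ^ 2 ≤ ENNReal.ofReal C * g x.1 := by
    dsimp only [g]
    rw [linkGraph_b_eq]
    refine (d.weight_mul_enorm_sq_boundary_δ_lift_eraseSimplex u x.1 x.2).trans_le ?_
    gcongr
    exact hC x.1 x.2
  calc _ ≤ ∑' x : LinkDart ρ × ρ.1, ENNReal.ofReal C * g x.1 := ENNReal.tsum_le_tsum hg
    _ = ρ.1.card * (ENNReal.ofReal C * ∑' e, g e) := by
      rw [ENNReal.tsum_prod (f := fun e _ => ENNReal.ofReal C * g e)]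
      simp only [tsum_fintype, Finset.sum_const, Finset.card_univ, Fintype.card_coe, nsmul_eq_mul,
        ENNReal.tsum_mul_left]
    _ = _ := by rw [WGraph.energy_eq_weightedSqNorm_dart]; rfl

theorem tsum_not_isFace_boundary_δ_lift_le (u : K.link ρ → ℂ) {C : ℝ}
    (hC : ∀ (e : LinkDart ρ) w, K.m (edgeSimplex e).1 / K.m (eraseSimplex e w).1 ≤ C) :
    ∑' τ : {τ : K.Simplex // ¬IsFace ρ.1 τ.1},
        ENNReal.ofReal (K.m τ.1.1) * ‖d.boundary (d.δ (d.lift ρ u)) τ‖ₑ ^ 2 ≤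
      ρ.1.card * (ENNReal.ofReal C * (K.linkGraph ρ).energy (WGraph.grad u)) := by
  let S : Set K.Simplex := {τ | ¬IsFace ρ.1 τ.1}
  let f (τ : K.Simplex) := ENNReal.ofReal (K.m τ.1) * ‖d.boundary (d.δ (d.lift ρ u)) τ‖ₑ ^ 2
  let q (x : LinkDart ρ × ρ.1) : K.Simplex := eraseSimplex x.1 x.2
  have hsupp : (S.indicator f).support ⊆ Set.range q := by
    intro τ hτ
    obtain ⟨hτS, hfτ⟩ := Set.indicator_apply_ne_zero.1 hτ
    obtain ⟨e, w, rfl⟩ := d.exists_eraseSimplex_of_boundary_δ_lift_ne_zero (u := u) hτS fun h =>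
      hfτ (by simp [f, h])
    exact ⟨(e, w), rfl⟩
  calc ∑' τ : S, f τ = ∑' τ, S.indicator f τ := tsum_subtype S f
    _ ≤ ∑' x, S.indicator f (q x) := tsum_le_tsum_comp_of_support_subset_range hsupp
    _ ≤ ∑' x, f (q x) := ENNReal.tsum_le_tsum fun x => Set.indicator_le_self _ _ _
    _ ≤ _ := d.tsum_boundary_δ_lift_eraseSimplex_le u hC

theorem isL2_boundary_δ_lift (hbal : K.LocallyBalanced) {u : K.link ρ → ℂ}
    (hu : u ∈ (K.linkGraph ρ).finiteEnergy) (hlap : weightedSqNorm (K.linkWeight ρ)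
      ((K.linkGraph ρ).laplacian (K.linkWeight ρ) u) ≠ ⊤) :
    K.IsL2 (d.boundary (d.δ (d.lift ρ u))) := by
  obtain ⟨C, hC⟩ := hbal ρ
  rw [WGraph.mem_finiteEnergy_iff] at hu
  have hle := d.tsum_not_isFace_boundary_δ_lift_le u (C := C) fun e w =>
    hC e.fst e.snd e.fst_ne_snd (edgeSimplex e).2 w w.2
  rw [isL2_iff, weightedSqNorm,
    ← ENNReal.summable.tsum_add_tsum_compl (s := {τ | IsFace ρ.1 τ.1}) ENNReal.summable]
  exact ENNReal.add_ne_top.2 ⟨(d.tsum_isFace_boundary_δ_lift u).trans_ne hlap, ne_top_of_le_ne_top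
    (by finiteness) hle⟩

theorem isL2_boundary_δ_lift_of_isMonopole (hbal : K.LocallyBalanced) {u : K.link ρ → ℂ}
    {v₀ : K.link ρ} (hu : (K.linkGraph ρ).IsMonopole (K.linkWeight ρ) v₀ u) :
    K.IsL2 (d.boundary (d.δ (d.lift ρ u))) := by
  refine d.isL2_boundary_δ_lift hbal hu.1 ?_
  rw [weightedSqNorm, hu.2, tsum_eq_single v₀ fun v hv => by simp [hv]]
  simp

end Coboundary

end WeightedComplex

end

theorem mainTheorem2 {X : Type*} [DecidableEq X] (K : WeightedComplex X) (d : K.Coboundary)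
    (hbal : K.LocallyBalanced) :
    (d.NeumannComplexProperty ↔ ∀ ρ : K.Simplex, K.LinkRecurrent ρ) ∧
    (∀ (ρ : K.Simplex) (c : (K.linkGraph ρ).toSimpleGraph.ConnectedComponent),
      ¬ ((K.linkGraph ρ).component c).Recurrent →
        ∃ v₀ ∈ c.supp, ∃ u, (K.linkGraph ρ).IsMonopole (K.linkWeight ρ) v₀ u) ∧
    (∀ (ρ : K.Simplex) (v₀ : K.link ρ) (u : K.link ρ → ℂ),
      (K.linkGraph ρ).IsMonopole (K.linkWeight ρ) v₀ u →
        K.IsL2 (d.δ (d.lift ρ u)) ∧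
        d.δ (d.lift ρ u) ∈ K.boundaryDomain ∧
        K.IsL2 (d.boundary (d.δ (d.lift ρ u))) ∧
        d.boundary (d.δ (d.lift ρ u)) ∈ K.boundaryDomain ∧
        d.boundary (d.boundary (d.δ (d.lift ρ u))) ρ ≠ 0) := by
  have hμ (ρ : K.Simplex) (v : K.link ρ) : K.linkWeight ρ v ≠ 0 :=
    (WeightedComplex.linkWeight_pos v).ne'
  have hmonopole (ρ : K.Simplex) (v₀ : K.link ρ) (u : K.link ρ → ℂ)
      (hu : (K.linkGraph ρ).IsMonopole (K.linkWeight ρ) v₀ u) :=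
    And.intro (d.isL2_δ_lift hu.1) (d.isL2_boundary_δ_lift_of_isMonopole hbal hu)
  refine ⟨⟨fun h ρ c => ?_, fun h ω hω hω' => ?_⟩, fun ρ c hc => ?_, fun ρ v₀ u hu => ?_⟩
  · by_contra hc
    obtain ⟨v₀, -, u, hu⟩ := (K.linkGraph ρ).exists_isMonopole (hμ ρ) c hc
    obtain ⟨hω, hω'⟩ := hmonopole ρ v₀ u hu
    exact d.boundary_boundary_δ_lift_ne_zero hu
      (congrFun (h _ ⟨hω, hω.mem_boundaryDomain, hω'⟩ hω'.mem_boundaryDomain) ρ)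
  · exact funext fun ρ => d.boundary_boundary_eq_zero hω.1 hω' (h ρ)
  · exact (K.linkGraph ρ).exists_isMonopole (hμ ρ) c hc
  · obtain ⟨hω, hω'⟩ := hmonopole ρ v₀ u hu
    exact ⟨hω, hω.mem_boundaryDomain, hω', hω'.mem_boundaryDomain,
      d.boundary_boundary_δ_lift_ne_zero hu⟩
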